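/- Let $d\in\{1,2,3\}$ and let $\mathcal T_h$ be an admissible (conforming) decomposition into finitely many $d$-simplices $\tau$ of (the closure of) a bounded open set $\Omega\subset\mathbb R^d$ that is the interior of its closure (for instance a convex polytope or a polyhedral Lipschitz domain). Put $h_\tau=\operatorname{diam}\tau$, $h=\max_\tau h_\tau$. Let $\varphi_1,\dots,\varphi_M$ be the continuous piecewise linear nodal basis functions of the mesh vertices lying in $\Omega$, and for a weight $w$ let $$M_{w,h}[j,i]=\int_\Omega w\,\varphi_i\varphi_j\,dx,\qquad K_{w,h}[j,i]=\int_\Omega w\,\nabla\varphi_i\cdot\nabla\varphi_j\,dx,\qquad M_h=M_{1,h},\quad K_h=K_{1,h}.$$ Let $\mathrm{lump}(M_h)[j,k]=\delta_{jk}\sum_{i=1}^M M_h[j,i]$ and $S_{\varrho h}=M_h+D_{\varrho h}$, where $D_{\varrho h}$ is one of - $h^2K_h$ (constant $H^{-1}$ regularization, $\varrho=h^2$); - $K_{\varrho_h,h}$ with $\varrho_h(x)=h_\tau^2$ for $x\in\tau$ (variable $H^{-1}$ regularization); - $h^4K_hM_h^{-1}K_h$ (constant $L^2$ regularization, $\varrho=h^4$);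 - $K_hM_{1/\varrho_h,h}^{-1}K_h$ with $\varrho_h(x)=h_\tau^4$ for $x\in\tau$ (variable $L^2$ regularization). Then the following hold. 1. $M_h$ and $M_{1/\varrho_h,h}$ (with $\varrho_h=h_\tau^4$ on $\tau$) are positive definite. For each of the four choices of $D_{\varrho h}$, the generalized eigenvalue problem $D_{\varrho h}v=\lambda M_hv$ has (if $M\ge1$) a largest real eigenvalue $\lambda_{\max}(M_h^{-1}D_{\varrho h})$, and for every $c\in\mathbb R$ such that $c^2$ is an upper bound of its eigenvalues, i.e. $c^2\ge\lambda_{\max}(M_h^{-1}D_{\varrho h})$, $$\frac1{d+2}\,(\mathrm{lump}(M_h)\,y,y)\;\le\;(S_{\varrho h}\,y,y)\;\le\;(1+c^2)\,(\mathrm{lump}(M_h)\,y,y)\qquad\text{for all }y\in\mathbb R^M .$$ 2. Such a $c$ can be chosen independently of $h$. Call the mesh shape regular with constant $\gamma>0$ if every $\tau$ contains a ball of radius $\gamma h_\tau$, and quasi-uniform with constant $q>0$ if $h\le q\,h_\tau$ for all $\tau$. For the two variable regularizations there is $c$ depending only on $d$ and $\gamma$ such that, for all $\Omega$ and all shape regular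 meshes with constant $\gamma$, $\lambda_{\max}(M_h^{-1}D_{\varrho h})\le c^2$ and the inequalities above hold with this $c$. For the two constant regularizations the same is true with $c$ depending only on $d$, $\gamma$ and $q$, for all $\Omega$ and all meshes that are shape regular with constant $\gamma$ and quasi-uniform with constant $q$. -/

import Mathlib

open MeasureTheory
open scoped InnerProductSpace Matrix

noncomputable section

/-- An admissible (conforming) decomposition of a set `Ω ⊆ ℝᵈ` into finitely many
`d`-dimensional simplices: a finite simplicial complex (two simplices meet in the convex hull of
their common vertices), all of whose faces are faces of `d`-simplices of the complex, and which
covers the closure of `Ω` exactly. -/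
structure SimplicialMesh {d : ℕ} (Ω : Set (EuclideanSpace ℝ (Fin d))) extends
    Geometry.SimplicialComplex ℝ (EuclideanSpace ℝ (Fin d)) where
  finite_faces : faces.Finite
  pure : ∀ s ∈ faces, ∃ τ ∈ faces, s ⊆ τ ∧ τ.card = d + 1
  cover : toSimplicialComplex.space = closure Ω

namespace SimplicialMesh

variable {d : ℕ} {Ω : Set (EuclideanSpace ℝ (Fin d))}

/-- The finite elements `τ`, i.e. the `d`-dimensional simplices, given by their vertex sets. -/
def elements (T : SimplicialMesh Ω) : Finset (Finset (EuclideanSpace ℝ (Fin d))) :=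
  T.finite_faces.toFinset.filter fun τ => τ.card = d + 1

theorem mem_elements (T : SimplicialMesh Ω) {τ : Finset (EuclideanSpace ℝ (Fin d))} :
    τ ∈ T.elements ↔ τ ∈ T.faces ∧ τ.card = d + 1 := by
  simp [elements]

/-- The vertices of an element, as an affine basis of `ℝᵈ`; its coordinates are the barycentric
coordinates of the element. -/
def vertexBasis (T : SimplicialMesh Ω) {τ : Finset (EuclideanSpace ℝ (Fin d))}
    (hτ : τ ∈ T.elements) : AffineBasis τ ℝ (EuclideanSpace ℝ (Fin d)) where
  toFun := (↑)
  ind' := T.indep (T.mem_elements.1 hτ).1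
  tot' := by
    rw [(T.indep (T.mem_elements.1 hτ).1).affineSpan_eq_top_iff_card_eq_finrank_add_one]
    simpa using (T.mem_elements.1 hτ).2

theorem finite_vertices (T : SimplicialMesh Ω) : T.vertices.Finite :=
  T.finite_faces.preimage Finset.singleton_injective.injOn

open Classical in
/-- The interior nodes: the vertices of the mesh that lie in the open set `Ω`.  They label the
degrees of freedom `1, …, M`. -/
def interiorNodes (T : SimplicialMesh Ω) : Finset (EuclideanSpace ℝ (Fin d)) :=
  T.finite_vertices.toFinset.filter fun p => p ∈ Ω

open Classical in
/-- The nodal (hat) basis function of the node `p`: on every element with vertex `p` it is the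
barycentric coordinate belonging to `p`, and it vanishes elsewhere.  It is the continuous function
that is affine on each element, equal to `1` at `p` and to `0` at all other nodes. -/
def hat (T : SimplicialMesh Ω) (p x : EuclideanSpace ℝ (Fin d)) : ℝ :=
  if h : ∃ τ, ∃ _ : τ ∈ T.elements, p ∈ τ ∧ x ∈ convexHull ℝ (τ : Set (EuclideanSpace ℝ (Fin d)))
  then (T.vertexBasis h.choose_spec.choose).coord
    ⟨p, h.choose_spec.choose_spec.1⟩ x
  else 0

/-- The local mesh size `h_τ`: the diameter of the element. -/
def localSize (_ : SimplicialMesh Ω) (τ : Finset (EuclideanSpace ℝ (Fin d))) : ℝ :=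
  Metric.diam (convexHull ℝ (τ : Set (EuclideanSpace ℝ (Fin d))))

/-- The global mesh size `h = max_τ h_τ`. -/
def meshSize (T : SimplicialMesh Ω) : ℝ := ⨆ τ : T.elements, T.localSize τ

open Classical in
/-- The mesh size function, `x ↦ h_τ` for `x ∈ τ`.  (On the set of measure zero where several
elements meet, one of them is chosen.) -/
def sizeAt (T : SimplicialMesh Ω) (x : EuclideanSpace ℝ (Fin d)) : ℝ :=
  if h : ∃ τ ∈ T.elements, x ∈ convexHull ℝ (τ : Set (EuclideanSpace ℝ (Fin d)))
  then T.localSize h.choose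
  else 0

/-- Shape regularity with constant `γ`: every element contains a ball of radius `γ h_τ`. -/
def ShapeRegular (T : SimplicialMesh Ω) (γ : ℝ) : Prop :=
  ∀ τ ∈ T.elements, ∃ x, Metric.closedBall x (γ * T.localSize τ) ⊆
    convexHull ℝ (τ : Set (EuclideanSpace ℝ (Fin d)))

/-- Quasi-uniformity with constant `q`: `h ≤ q h_τ` for every element. -/
def QuasiUniform (T : SimplicialMesh Ω) (q : ℝ) : Prop :=
  ∀ τ ∈ T.elements, T.meshSize ≤ q * T.localSize τ

/-- The mass matrix `∫_Ω w φᵢ φⱼ dx` with weight `w`. -/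
def weightedMass (T : SimplicialMesh Ω) (w : EuclideanSpace ℝ (Fin d) → ℝ) :
    Matrix T.interiorNodes T.interiorNodes ℝ :=
  Matrix.of fun j i => ∫ x in Ω, w x * (T.hat i x * T.hat j x)

/-- The stiffness matrix `∫_Ω w ∇φᵢ · ∇φⱼ dx` with weight `w`.  The hat functions are affine on
every element, so that their weak gradient is their classical gradient, which exists almost
everywhere. -/
def weightedStiffness (T : SimplicialMesh Ω) (w : EuclideanSpace ℝ (Fin d) → ℝ) :
    Matrix T.interiorNodes T.interiorNodes ℝ :=
  Matrix.of fun j i => ∫ x in Ω, w x * ⟪gradient (T.hat i) x, gradient (T.hat j) x⟫_ℝ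

/-- The mass matrix `M_h`. -/
def mass (T : SimplicialMesh Ω) : Matrix T.interiorNodes T.interiorNodes ℝ :=
  T.weightedMass fun _ => 1

/-- The stiffness matrix `K_h` of the Laplacian. -/
def stiffness (T : SimplicialMesh Ω) : Matrix T.interiorNodes T.interiorNodes ℝ :=
  T.weightedStiffness fun _ => 1

end SimplicialMesh

/-- The four regularizations of the distributed control problem for the Poisson equation. -/
inductive Regularization where
  /-- `H⁻¹` regularization with constant parameter `ϱ = h²` -/
  | constantHMinusOne
  /-- `H⁻¹` regularization with variable parameter `ϱ_h(x) = h_τ²`, `x ∈ τ` -/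
  | variableHMinusOne
  /-- `L²` regularization with constant parameter `ϱ = h⁴` -/
  | constantLTwo
  /-- `L²` regularization with variable parameter `ϱ_h(x) = h_τ⁴`, `x ∈ τ` -/
  | variableLTwo

namespace SimplicialMesh

variable {d : ℕ} {Ω : Set (EuclideanSpace ℝ (Fin d))}

open Classical in
/-- The regularization matrix `D_{ϱh}`. -/
def regMatrix (T : SimplicialMesh Ω) :
    Regularization → Matrix T.interiorNodes T.interiorNodes ℝ
  | .constantHMinusOne => T.meshSize ^ 2 • T.stiffness
  | .variableHMinusOne => T.weightedStiffness fun x => T.sizeAt x ^ 2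
  | .constantLTwo => T.meshSize ^ 4 • (T.stiffness * T.mass⁻¹ * T.stiffness)
  | .variableLTwo =>
      T.stiffness * (T.weightedMass fun x => 1 / T.sizeAt x ^ 4)⁻¹ * T.stiffness

/-- The Schur complement `S_{ϱh} = M_h + D_{ϱh}`. -/
def schur (T : SimplicialMesh Ω) (r : Regularization) :
    Matrix T.interiorNodes T.interiorNodes ℝ :=
  T.mass + T.regMatrix r

end SimplicialMesh

open Classical in
/-- Mass lumping: the diagonal matrix of the row sums. -/
def lump {n : Type*} [Fintype n] (A : Matrix n n ℝ) : Matrix n n ℝ :=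
  Matrix.diagonal fun j => ∑ i, A j i

/-- `μ` is an eigenvalue of the generalized eigenvalue problem `D v = μ M v`. -/
def IsGenEigenvalue {n : Type*} [Fintype n] (D M : Matrix n n ℝ) (μ : ℝ) : Prop :=
  ∃ v : n → ℝ, v ≠ 0 ∧ D *ᵥ v = μ • (M *ᵥ v)

/-- The spectral equivalence inequalities
`c₁ (C y, y) ≤ (S y, y) ≤ c₂ (C y, y)` for all vectors `y`. -/
def SpectrallyEquivalent {n : Type*} [Fintype n] (c₁ c₂ : ℝ) (C S : Matrix n n ℝ) : Prop :=
  ∀ y : n → ℝ, c₁ * ((C *ᵥ y) ⬝ᵥ y) ≤ (S *ᵥ y) ⬝ᵥ y ∧ (S *ᵥ y) ⬝ᵥ y ≤ c₂ * ((C *ᵥ y) ⬝ᵥ y)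

end

/-! Both inequalities reduce to comparing quadratic forms, and most of these comparisons are made
element by element. On a simplex the mass matrix is `|τ| / ((d+1)(d+2))` times the identity plus the
all-ones matrix, restricted to the interior nodes of `τ`. Its form therefore dominates `|τ| /
((d+1)(d+2)) ∑ yᵢ²`, while a row sum is at most `d + 2` times that factor. Summation gives `lump M ≤
(d+2) M`, and adding `D ≥ 0` gives the lower bound. For the upper bound, `M ≤ lump M` because the
entries of `M` are nonnegative, and `D ≤ c² M` by the Rayleigh quotient.

Uniformity in `h` comes from the local inverse inequality `h_τ² K_τ ≤ C M_τ`: a barycentric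
coordinate stays in `[0, 1]` on a ball of radius `γ h_τ`, so its gradient has norm at most `1 / (γ
h_τ)`. For the `L²` regularizations the inverse of the mass matrix is nonlocal. It is removed by
duality: `(K M⁻¹ K y, y)` is the maximum over `z` of `2 (K z, y) - (M z, z)`, and with Young's
inequality this is bounded by forms to which the inverse inequality applies. -/

section GeneralizedEigenvalues

/-! ### Symmetric pencils, duality and lumping. -/

variable {n : Type*} [Fintype n] {A D K M N : Matrix n n ℝ}

theorem Matrix.IsHermitian.mulVec_dotProduct_comm (hA : A.IsHermitian) (x y : n → ℝ) :
    (A *ᵥ x) ⬝ᵥ y = (A *ᵥ y) ⬝ᵥ x := by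
  have h : Aᵀ = A := by simpa [Matrix.conjTranspose_eq_transpose_of_trivial] using hA.eq
  rw [dotProduct_comm, Matrix.dotProduct_mulVec, ← Matrix.mulVec_transpose, h]

theorem Matrix.PosDef.mulVec_dotProduct_pos (hM : M.PosDef) {y : n → ℝ} (hy : y ≠ 0) :
    0 < (M *ᵥ y) ⬝ᵥ y := by
  simpa [dotProduct_comm] using hM.dotProduct_mulVec_pos hy

theorem Matrix.PosSemidef.mulVec_dotProduct_nonneg (hM : M.PosSemidef) (y : n → ℝ) :
    0 ≤ (M *ᵥ y) ⬝ᵥ y := by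
  simpa [dotProduct_comm] using hM.dotProduct_mulVec_nonneg y

theorem Matrix.posSemidef_of_mulVec_dotProduct_nonneg (hA : A.IsHermitian)
    (h : ∀ y : n → ℝ, 0 ≤ (A *ᵥ y) ⬝ᵥ y) : A.PosSemidef :=
  Matrix.posSemidef_iff_dotProduct_mulVec.2 ⟨hA, fun y => by simpa [dotProduct_comm] using h y⟩

theorem Matrix.posDef_of_mulVec_dotProduct_pos (hA : A.IsHermitian)
    (h : ∀ y : n → ℝ, y ≠ 0 → 0 < (A *ᵥ y) ⬝ᵥ y) : A.PosDef :=
  Matrix.posDef_iff_dotProduct_mulVec.2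
    ⟨hA, fun y hy => by simpa [dotProduct_comm] using h y hy⟩

theorem IsGenEigenvalue.le (hM : M.PosDef) {c μ : ℝ}
    (h : ∀ y : n → ℝ, (D *ᵥ y) ⬝ᵥ y ≤ c * ((M *ᵥ y) ⬝ᵥ y)) (hμ : IsGenEigenvalue D M μ) :
    μ ≤ c := by
  obtain ⟨v, hv, hDv⟩ := hμ
  have h1 := h v
  rw [hDv, smul_dotProduct, smul_eq_mul] at h1
  exact le_of_mul_le_mul_right h1 (hM.mulVec_dotProduct_pos hv)

/-- The largest generalized eigenvalue of a symmetric pencil is the maximum of its Rayleigh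
quotient. -/
theorem exists_isGreatest_isGenEigenvalue [Nonempty n] (hD : D.IsHermitian) (hM : M.PosDef) :
    ∃ μ, IsGreatest {μ | IsGenEigenvalue D M μ} μ ∧
      ∀ y : n → ℝ, (D *ᵥ y) ⬝ᵥ y ≤ μ * ((M *ᵥ y) ⬝ᵥ y) := by
  classical
  -- The norm is the sup norm here. Any compact set that meets every ray and avoids `0` would do,
  -- since the Rayleigh quotient is homogeneous of degree zero.
  have hne : (Metric.sphere (0 : n → ℝ) 1).Nonempty := NormedSpace.sphere_nonempty.2 zero_le_one
  have hpos : ∀ y ∈ Metric.sphere (0 : n → ℝ) 1, 0 < (M *ᵥ y) ⬝ᵥ y := fun y hy =>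
    hM.mulVec_dotProduct_pos (ne_zero_of_mem_unit_sphere ⟨y, hy⟩)
  have hcont : ∀ B : Matrix n n ℝ, Continuous fun y : n → ℝ => (B *ᵥ y) ⬝ᵥ y := fun B => by
    fun_prop
  obtain ⟨v, hv, hmax⟩ := (isCompact_sphere (0 : n → ℝ) 1).exists_isMaxOn hne
    (ContinuousOn.div (hcont D).continuousOn (hcont M).continuousOn fun y hy => (hpos y hy).ne')
  set μ := ((D *ᵥ v) ⬝ᵥ v) / ((M *ᵥ v) ⬝ᵥ v) with hμ
  have hle : ∀ y : n → ℝ, (D *ᵥ y) ⬝ᵥ y ≤ μ * ((M *ᵥ y) ⬝ᵥ y) := by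
    intro y
    rcases eq_or_ne y 0 with rfl | hy
    · simp
    have hy' : ‖y‖ ≠ 0 := norm_ne_zero_iff.2 hy
    have hmem : ‖y‖⁻¹ • y ∈ Metric.sphere (0 : n → ℝ) 1 := by
      simp [norm_smul, hy']
    have h1 := hmax hmem
    simp only [Set.mem_ofPred_eq, Pi.div_apply] at h1
    rw [← hμ, div_le_iff₀ (hpos _ hmem)] at h1
    simp only [Matrix.mulVec_smul, smul_dotProduct, dotProduct_smul, smul_eq_mul] at h1
    have h2 : 0 < ‖y‖⁻¹ * ‖y‖⁻¹ := by positivity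
    refine le_of_mul_le_mul_left ?_ h2
    calc _ = ‖y‖⁻¹ * (‖y‖⁻¹ * (D *ᵥ y ⬝ᵥ y)) := by ring
      _ ≤ _ := h1
      _ = _ := by ring
  refine ⟨μ, ⟨⟨v, ne_zero_of_mem_unit_sphere ⟨v, hv⟩, ?_⟩, fun ν hν => hν.le hM hle⟩, hle⟩
  have hsub : ∀ y : n → ℝ, (μ • M - D) *ᵥ y = μ • (M *ᵥ y) - D *ᵥ y := fun y => by
    rw [Matrix.sub_mulVec, Matrix.smul_mulVec]
  have hherm : (μ • M - D).IsHermitian := (hM.isHermitian.smul (IsSelfAdjoint.all μ)).sub hD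
  have hpsd : (μ • M - D).PosSemidef :=
    Matrix.posSemidef_of_mulVec_dotProduct_nonneg hherm fun y => by
      rw [hsub, sub_dotProduct, smul_dotProduct, smul_eq_mul]
      exact sub_nonneg.2 (hle y)
  -- A positive semidefinite form vanishes only on its kernel, so the maximizer is an eigenvector
  -- without any differentiation.
  have hzero : (μ • M - D) *ᵥ v = 0 := by
    refine (hpsd.dotProduct_mulVec_zero_iff v).1 ?_
    rw [star_trivial, dotProduct_comm, hsub, sub_dotProduct, smul_dotProduct, smul_eq_mul, hμ,
      div_mul_cancel₀ _ (hpos v hv).ne', sub_self]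
  rw [hsub, sub_eq_zero] at hzero
  exact hzero.symm

/-- The converse of `IsGenEigenvalue.le`: since the maximum of the Rayleigh quotient is itself an
eigenvalue, a bound on eigenvalues bounds the whole form. With no degrees of freedom there is no
eigenvalue, but also nothing to prove. -/
theorem mulVec_dotProduct_le_of_isGenEigenvalue_le (hD : D.IsHermitian) (hM : M.PosDef) {c : ℝ}
    (h : ∀ μ, IsGenEigenvalue D M μ → μ ≤ c) (y : n → ℝ) :
    (D *ᵥ y) ⬝ᵥ y ≤ c * ((M *ᵥ y) ⬝ᵥ y) := by
  cases isEmpty_or_nonempty n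
  · simp [Subsingleton.elim y 0]
  obtain ⟨μ, hμ, hle⟩ := exists_isGreatest_isGenEigenvalue hD hM
  exact (hle y).trans
    (mul_le_mul_of_nonneg_right (h μ hμ.1) (hM.posSemidef.mulVec_dotProduct_nonneg y))

theorem Matrix.PosDef.posSemidef_mul_inv_mul [DecidableEq n] (hM : M.PosDef)
    (hK : K.IsHermitian) : (K * M⁻¹ * K).PosSemidef := by
  have h := hM.inv.posSemidef.conjTranspose_mul_mul_same K
  rwa [hK.eq] at h

/-- The quadratic form of `K M⁻¹ K` is the value of a concave maximization problem; a bound for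
the latter is a bound for the former. -/
theorem Matrix.PosDef.mul_inv_mul_form_le [DecidableEq n] (hM : M.PosDef) (hK : K.IsHermitian)
    {C : ℝ} (h : ∀ y z : n → ℝ,
      2 * ((K *ᵥ z) ⬝ᵥ y) ≤ (M *ᵥ z) ⬝ᵥ z + C * ((N *ᵥ y) ⬝ᵥ y)) (y : n → ℝ) :
    ((K * M⁻¹ * K) *ᵥ y) ⬝ᵥ y ≤ C * ((N *ᵥ y) ⬝ᵥ y) := by
  -- The maximizer of `2 (K z, y) - (M z, z)`. There both `(K z, y)` and `(M z, z)` equal the form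
  -- to be bounded, so one copy cancels.
  set z := M⁻¹ *ᵥ (K *ᵥ y) with hz
  have hMz : M *ᵥ z = K *ᵥ y := by
    rw [hz, Matrix.mulVec_mulVec, Matrix.mul_nonsing_inv _ ((Matrix.isUnit_iff_isUnit_det _).1
      hM.isUnit), Matrix.one_mulVec]
  have hX : (K * M⁻¹ * K) *ᵥ y = K *ᵥ z := by
    rw [hz, Matrix.mulVec_mulVec, Matrix.mulVec_mulVec]
  have h1 := h y z
  rw [hMz, hK.mulVec_dotProduct_comm y z] at h1
  rw [hX]
  linarith

/-- Cauchy–Schwarz with weights for a positive semidefinite form. -/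
theorem Matrix.PosSemidef.two_mul_form_le (hK : K.PosSemidef) {α β : ℝ} (hα : 0 < α)
    (hαβ : α * β = 1) (y z : n → ℝ) :
    2 * ((K *ᵥ z) ⬝ᵥ y) ≤ α * ((K *ᵥ z) ⬝ᵥ z) + β * ((K *ᵥ y) ⬝ᵥ y) := by
  -- Expanding this and dividing by `α` gives the claim, as `β = 1 / α`.
  have h1 := hK.mulVec_dotProduct_nonneg (α • z - y)
  simp only [Matrix.mulVec_sub, Matrix.mulVec_smul, sub_dotProduct, dotProduct_sub,
    smul_dotProduct, dotProduct_smul, smul_eq_mul] at h1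
  rw [hK.isHermitian.mulVec_dotProduct_comm y z] at h1
  refine le_of_mul_le_mul_left ?_ hα
  linear_combination h1 - ((K *ᵥ y) ⬝ᵥ y) * hαβ

/-- The form of a symmetric nonnegative matrix is dominated by that of its lumped matrix. -/
theorem mulVec_dotProduct_le_lump (hA : A.IsHermitian) (hA0 : ∀ i j, 0 ≤ A i j) (y : n → ℝ) :
    (A *ᵥ y) ⬝ᵥ y ≤ (lump A *ᵥ y) ⬝ᵥ y := by
  classical
  have hsymm : ∀ i j, A i j = A j i := fun i j => by simpa using (hA.apply i j).symm
  have h1 : (A *ᵥ y) ⬝ᵥ y = ∑ i, ∑ j, A i j * (y i * y j) := by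
    simp only [Matrix.mulVec, dotProduct, Finset.sum_mul]
    exact Finset.sum_congr rfl fun i _ => Finset.sum_congr rfl fun j _ => by ring
  have h2 : (lump A *ᵥ y) ⬝ᵥ y = ∑ i, ∑ j, A i j * (y i * y i) := by
    simp only [lump, Matrix.mulVec_diagonal, dotProduct, Finset.sum_mul]
    exact Finset.sum_congr rfl fun i _ => Finset.sum_congr rfl fun j _ => by ring
  have h3 : (lump A *ᵥ y) ⬝ᵥ y = ∑ i, ∑ j, A i j * (y j * y j) := by
    rw [h2, Finset.sum_comm]
    exact Finset.sum_congr rfl fun i _ => Finset.sum_congr rfl fun j _ => by rw [hsymm]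
  -- By symmetry the lumped form is a double sum of `A i j` against either `yᵢ²` or `yⱼ²`. Using one
  -- of each leaves `A i j (yᵢ - yⱼ)² ≥ 0` termwise.
  have h4 : 2 * ((A *ᵥ y) ⬝ᵥ y) ≤ (lump A *ᵥ y) ⬝ᵥ y + (lump A *ᵥ y) ⬝ᵥ y := by
    nth_rewrite 1 [h2]
    rw [h1, h3, Finset.mul_sum, ← Finset.sum_add_distrib]
    refine Finset.sum_le_sum fun i _ => ?_
    rw [Finset.mul_sum, ← Finset.sum_add_distrib]
    refine Finset.sum_le_sum fun j _ => ?_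
    nlinarith [mul_nonneg (hA0 i j) (sq_nonneg (y i - y j))]
  linarith

end GeneralizedEigenvalues

/-! ### Exact integrals of products of barycentric coordinates. -/

section SimplexIntegrals

variable {ι E : Type*} [NormedAddCommGroup E] [NormedSpace ℝ E]

theorem AffineBasis.isCompact_convexHull [Finite ι] (b : AffineBasis ι ℝ E) :
    IsCompact (convexHull ℝ (Set.range b)) :=
  (Set.finite_range b).isCompact_convexHull ℝ

theorem AffineBasis.coord_add_smul_sub [DecidableEq ι] (b : AffineBasis ι ℝ E)
    (i j k : ι) (x : E) (t : ℝ) :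
    b.coord k (x + t • (b i - b j)) =
      b.coord k x + t * ((if k = i then 1 else 0) - if k = j then 1 else 0) := by
  have h : (b.coord k).linear (b i - b j) =
      (if k = i then 1 else 0) - if k = j then (1 : ℝ) else 0 := by
    have := (b.coord k).linearMap_vsub (b i) (b j)
    rw [vsub_eq_sub, vsub_eq_sub, b.coord_apply, b.coord_apply] at this
    exact this
  have h2 := (b.coord k).map_vadd x (t • (b i - b j))
  rw [map_smul, h, vadd_eq_add, vadd_eq_add, add_comm, smul_eq_mul] at h2
  rw [h2, add_comm]

/-- The half of a simplex on which the `j`-th coordinate is at most the `i`-th one is an affine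
image of the simplex. -/
theorem AffineBasis.shear_image_convexHull (b : AffineBasis ι ℝ E) {i j : ι} (hij : i ≠ j) :
    (fun x => x + b.coord j x • ((1 / 2 : ℝ) • (b i - b j))) '' convexHull ℝ (Set.range b) =
      convexHull ℝ (Set.range b) ∩ {x | b.coord j x ≤ b.coord i x} := by
  classical
  rw [b.convexHull_eq_nonneg_coord]
  ext y
  constructor
  · rintro ⟨x, hx, rfl⟩
    refine ⟨fun k => ?_, ?_⟩
    · have hk := hx k
      have hj := hx j
      simp only [smul_smul, b.coord_add_smul_sub]
      split_ifs with h1 h2 h2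
      · exact absurd (h1.symm.trans h2) hij
      · linarith
      · subst h2; linarith
      · linarith
    · have hk := hx i
      simp only [Set.mem_ofPred_eq, smul_smul, b.coord_add_smul_sub, if_neg hij, if_neg hij.symm,
        if_true]
      linarith
  · rintro ⟨hy, hle⟩
    -- The shear halves the `j`-th coordinate and gives the loss to the `i`-th, so its inverse
    -- doubles the `j`-th. The new `i`-th coordinate is the difference of the two, nonnegative
    -- exactly on this half.
    refine ⟨y + (-b.coord j y) • (b i - b j), fun k => ?_, ?_⟩
    · have hk := hy k
      have hj := hy j
      have hle' : b.coord j y ≤ b.coord i y := hle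
      rw [b.coord_add_smul_sub]
      split_ifs with h1 h2 h2
      · linarith
      · subst h1; linarith
      · subst h2; linarith
      · linarith
    · simp only [b.coord_add_smul_sub, if_neg hij.symm, if_true]
      module

variable [FiniteDimensional ℝ E]

theorem AffineBasis.continuous_coord (b : AffineBasis ι ℝ E) (i : ι) : Continuous (b.coord i) :=
  (b.coord i).continuous_of_finiteDimensional

variable [MeasurableSpace E] [BorelSpace E] (μ : Measure E) [μ.IsAddHaarMeasure]

/-- Change of variables for the affine shear `x ↦ x + φ(x) v`. -/
theorem setIntegral_image_affine_shear (φ : E →ᵃ[ℝ] ℝ) (v : E) (hv : 1 + φ.linear v ≠ 0)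
    {s : Set E} (hs : MeasurableSet s) (g : E → ℝ) :
    ∫ x in (fun x => x + φ x • v) '' s, g x ∂μ =
      |1 + φ.linear v| * ∫ x in s, g (x + φ x • v) ∂μ := by
  have hφ : ∀ x, φ x = φ.linear x + φ 0 := fun x => congrFun φ.decomp x
  have hd : ∀ x ∈ s, HasFDerivWithinAt (fun x => x + φ x • v)
      (LinearMap.toContinuousLinearMap (LinearMap.transvection φ.linear v)) s x := by
    intro x _
    have h := (LinearMap.toContinuousLinearMap
      (LinearMap.transvection φ.linear v)).hasFDerivAt (x := x)
    refine ((h.add_const (φ 0 • v)).congr_of_eventuallyEq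
      (Filter.Eventually.of_forall fun x => ?_)).hasFDerivWithinAt
    simp [LinearMap.transvection, hφ x, add_smul, add_assoc]
  have hinj : Set.InjOn (fun x => x + φ x • v) s := by
    intro x _ y _ hxy
    have h0 : (x - y) + φ.linear (x - y) • v = 0 := by
      have : x + φ x • v - (y + φ y • v) = 0 := sub_eq_zero.2 hxy
      rw [← this, hφ x, hφ y, map_sub]
      module
    have h1 : φ.linear (x - y) * (1 + φ.linear v) = 0 := by
      have := congrArg φ.linear h0
      rw [map_add, map_smul, map_zero, smul_eq_mul] at this
      linear_combination this
    rw [(mul_eq_zero.1 h1).resolve_right hv, zero_smul, add_zero] at h0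
    exact sub_eq_zero.1 h0
  rw [integral_image_eq_integral_abs_det_fderiv_smul μ hs hd hinj]
  have hdet : (LinearMap.toContinuousLinearMap (LinearMap.transvection φ.linear v)).det
      = 1 + φ.linear v := by
    rw [ContinuousLinearMap.det, LinearMap.coe_toContinuousLinearMap, LinearMap.transvection.det]
  simp only [hdet, smul_eq_mul]
  exact integral_const_mul _ _

variable [Fintype ι] (b : AffineBasis ι ℝ E)

/-- Bisection of a simplex: the integral is the average of the integrals over the two halves,
each of which is parametrized by the whole simplex. -/
theorem AffineBasis.setIntegral_convexHull_bisect {i j : ι} (hij : i ≠ j) {g : E → ℝ}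
    (hg : Continuous g) :
    ∫ x in convexHull ℝ (Set.range b), g x ∂μ =
      1 / 2 * (∫ x in convexHull ℝ (Set.range b),
          g (x + b.coord j x • ((1 / 2 : ℝ) • (b i - b j))) ∂μ) +
      1 / 2 * ∫ x in convexHull ℝ (Set.range b),
          g (x + b.coord i x • ((1 / 2 : ℝ) • (b j - b i))) ∂μ := by
  classical
  set S := convexHull ℝ (Set.range b)
  have hS : MeasurableSet S := b.isCompact_convexHull.isClosed.measurableSet
  -- The Jacobian of the shear: each half has half the volume.
  have half : ∀ k l : ι, k ≠ l →
      1 + (b.coord l).linear ((1 / 2 : ℝ) • (b k - b l)) = 1 / 2 := by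
    intro k l hkl
    have := (b.coord l).linearMap_vsub (b k) (b l)
    rw [vsub_eq_sub, vsub_eq_sub, b.coord_apply, b.coord_apply, if_neg hkl.symm, if_pos rfl]
      at this
    rw [map_smul, this]
    norm_num
  have key : ∀ k l : ι, k ≠ l → ∫ x in S ∩ {x | b.coord l x ≤ b.coord k x}, g x ∂μ =
      1 / 2 * ∫ x in S, g (x + b.coord l x • ((1 / 2 : ℝ) • (b k - b l))) ∂μ := by
    intro k l hkl
    rw [← b.shear_image_convexHull hkl, setIntegral_image_affine_shear μ (b.coord l) _
      (by rw [half k l hkl]; norm_num) hS, half k l hkl]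
    norm_num
  rw [← key i j hij, ← key j i hij.symm]
  have hint : IntegrableOn g S μ := hg.continuousOn.integrableOn_compact b.isCompact_convexHull
  have hmeas : ∀ k l : ι, MeasurableSet (S ∩ {x | b.coord l x ≤ b.coord k x}) := fun k l =>
    hS.inter (isClosed_le (b.continuous_coord l) (b.continuous_coord k)).measurableSet
  rw [← setIntegral_union₀ ?_ (hmeas j i).nullMeasurableSet
    (hint.mono_set Set.inter_subset_left) (hint.mono_set Set.inter_subset_left)]
  · congr 2
    ext x
    simp only [Set.mem_union, Set.mem_inter_iff, Set.mem_ofPred_eq]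
    constructor
    · intro hx
      exact (le_total (b.coord j x) (b.coord i x)).imp (⟨hx, ·⟩) (⟨hx, ·⟩)
    · rintro (h | h) <;> exact h.1
  -- The two halves overlap only in the bisecting hyperplane, which is proper because it misses the
  -- vertex `b i`.
  · refine measure_mono_null (t := ((AffineSubspace.mk' (0 : ℝ) ⊥).comap
      (b.coord i - b.coord j) : Set E)) ?_ (Measure.addHaar_affineSubspace μ _ ?_)
    · rintro x ⟨h1, h2⟩
      have h1' : b.coord j x ≤ b.coord i x := h1.2
      have h2' : b.coord i x ≤ b.coord j x := h2.2
      simp [le_antisymm h2' h1']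
    · intro htop
      have : b i ∈ (AffineSubspace.mk' (0 : ℝ) ⊥).comap (b.coord i - b.coord j) := by
        rw [htop]; trivial
      simp [b.coord_apply, hij.symm] at this

theorem AffineBasis.setIntegral_coord_quadratic (i j : ι) (p q r : ℝ) :
    ∫ x in convexHull ℝ (Set.range b), (p * (b.coord i x * b.coord i x) +
        q * (b.coord i x * b.coord j x) + r * (b.coord j x * b.coord j x)) ∂μ =
      p * (∫ x in convexHull ℝ (Set.range b), b.coord i x * b.coord i x ∂μ) +
        q * (∫ x in convexHull ℝ (Set.range b), b.coord i x * b.coord j x ∂μ) +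
        r * ∫ x in convexHull ℝ (Set.range b), b.coord j x * b.coord j x ∂μ := by
  have hint : ∀ (c : ℝ) (k l : ι), IntegrableOn (fun x => c * (b.coord k x * b.coord l x))
      (convexHull ℝ (Set.range b)) μ := fun c k l =>
    ((continuous_const.mul ((b.continuous_coord k).mul
      (b.continuous_coord l))).continuousOn).integrableOn_compact b.isCompact_convexHull
  have h1 := integral_add ((hint p i i).add (hint q i j)) (hint r j j)
  simp only [Pi.add_apply] at h1
  rw [h1, integral_add (hint p i i) (hint q i j), integral_const_mul, integral_const_mul,
    integral_const_mul]

/-- Products of barycentric coordinates of two different vertices: half of the squares. -/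
theorem AffineBasis.setIntegral_coord_mul_coord_of_ne {i j : ι} (hij : i ≠ j) :
    (∫ x in convexHull ℝ (Set.range b), b.coord i x * b.coord i x ∂μ =
      ∫ x in convexHull ℝ (Set.range b), b.coord j x * b.coord j x ∂μ) ∧
    ∫ x in convexHull ℝ (Set.range b), b.coord i x * b.coord j x ∂μ =
      1 / 2 * ∫ x in convexHull ℝ (Set.range b), b.coord j x * b.coord j x ∂μ := by
  classical
  have hc : ∀ k l : ι, Continuous fun x => b.coord k x * b.coord l x := fun k l =>
    (b.continuous_coord k).mul (b.continuous_coord l)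
  have h1 := b.setIntegral_convexHull_bisect μ hij (hc i i)
  have h2 := b.setIntegral_convexHull_bisect μ hij (hc i j)
  have e1 := b.setIntegral_coord_quadratic μ i j 1 1 (1 / 4)
  have e2 := b.setIntegral_coord_quadratic μ i j (1 / 4) 0 0
  have e3 := b.setIntegral_coord_quadratic μ i j 0 (1 / 2) (1 / 4)
  have e4 := b.setIntegral_coord_quadratic μ i j (1 / 4) (1 / 2) 0
  simp only [smul_smul, b.coord_add_smul_sub, if_neg hij, if_neg hij.symm, if_true] at h1 h2
  have f1 : ∀ x, (b.coord i x + b.coord j x * (1 / 2) * (1 - 0)) *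
      (b.coord i x + b.coord j x * (1 / 2) * (1 - 0)) = 1 * (b.coord i x * b.coord i x) +
        1 * (b.coord i x * b.coord j x) + 1 / 4 * (b.coord j x * b.coord j x) := fun x => by ring
  have f2 : ∀ x, (b.coord i x + b.coord i x * (1 / 2) * (0 - 1)) *
      (b.coord i x + b.coord i x * (1 / 2) * (0 - 1)) = 1 / 4 * (b.coord i x * b.coord i x) +
        0 * (b.coord i x * b.coord j x) + 0 * (b.coord j x * b.coord j x) := fun x => by ring
  have f3 : ∀ x, (b.coord i x + b.coord j x * (1 / 2) * (1 - 0)) *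
      (b.coord j x + b.coord j x * (1 / 2) * (0 - 1)) = 0 * (b.coord i x * b.coord i x) +
        1 / 2 * (b.coord i x * b.coord j x) + 1 / 4 * (b.coord j x * b.coord j x) :=
    fun x => by ring
  have f4 : ∀ x, (b.coord i x + b.coord i x * (1 / 2) * (0 - 1)) *
      (b.coord j x + b.coord i x * (1 / 2) * (1 - 0)) = 1 / 4 * (b.coord i x * b.coord i x) +
        1 / 2 * (b.coord i x * b.coord j x) + 0 * (b.coord j x * b.coord j x) :=
    fun x => by ring
  simp only [f1, f2, e1, e2] at h1
  simp only [f3, f4, e3, e4] at h2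
  -- Write `I` for the integrals of products. Bisection gives `3 Iᵢᵢ = 4 Iᵢⱼ + Iⱼⱼ` and `4 Iᵢⱼ = Iᵢᵢ
  -- + Iⱼⱼ`, which force `Iᵢᵢ = Iⱼⱼ = 2 Iᵢⱼ`.
  constructor <;> linarith

/-- The local mass matrix of a simplex. -/
theorem AffineBasis.setIntegral_coord_mul_coord [DecidableEq ι] (i j : ι) :
    ∫ x in convexHull ℝ (Set.range b), b.coord i x * b.coord j x ∂μ =
      μ.real (convexHull ℝ (Set.range b)) / (Fintype.card ι * (Fintype.card ι + 1)) *
        (1 + if i = j then 1 else 0) := by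
  set S := convexHull ℝ (Set.range b)
  set a := ∫ x in S, b.coord j x * b.coord j x ∂μ with ha
  have hsq : ∀ k, ∫ x in S, b.coord k x * b.coord k x ∂μ = a := fun k => by
    rcases eq_or_ne k j with rfl | hk
    · rfl
    · exact (b.setIntegral_coord_mul_coord_of_ne μ hk).1
  have hall : ∀ k l, ∫ x in S, b.coord k x * b.coord l x ∂μ =
      a / 2 * (1 + if k = l then 1 else 0) := fun k l => by
    split_ifs with hkl
    · rw [hkl, hsq]; ring
    · rw [(b.setIntegral_coord_mul_coord_of_ne μ hkl).2, hsq]; ring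
  have hint : ∀ k l : ι, IntegrableOn (fun x => b.coord k x * b.coord l x) S μ := fun k l =>
    (((b.continuous_coord k).mul
      (b.continuous_coord l)).continuousOn).integrableOn_compact b.isCompact_convexHull
  -- Integrating the square of `∑ λₖ = 1` fixes the remaining scale: with `n` vertices there are
  -- `n²` terms `a / 2`, and the `n` diagonal ones count twice.
  have hV : μ.real S = Fintype.card ι * (Fintype.card ι + 1) * (a / 2) := by
    calc μ.real S = ∫ x in S, (∑ k, ∑ l, b.coord k x * b.coord l x) ∂μ := by
          simp only [← Finset.mul_sum, ← Finset.sum_mul, b.sum_coord_apply_eq_one]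
          simp
      _ = ∑ k, ∑ l, ∫ x in S, b.coord k x * b.coord l x ∂μ := by
          rw [integral_finsetSum _ fun k _ => integrable_finsetSum _ fun l _ => hint k l]
          exact Finset.sum_congr rfl fun k _ => integral_finsetSum _ fun l _ => hint k l
      _ = _ := by
          simp only [hall, ← Finset.mul_sum, Finset.sum_add_distrib, Finset.sum_ite_eq,
            Finset.mem_univ, if_true, Finset.sum_const, Finset.card_univ, nsmul_eq_mul]
          ring
  have hcard : (0 : ℝ) < Fintype.card ι := by
    exact_mod_cast Fintype.card_pos_iff.2 ⟨i⟩
  rw [hall, hV]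
  field_simp

end SimplexIntegrals

/-! ### Geometry of the elements and elementwise integration. -/

namespace SimplicialMesh

variable {d : ℕ} {Ω : Set (EuclideanSpace ℝ (Fin d))} (T : SimplicialMesh Ω)
  {τ : Finset (EuclideanSpace ℝ (Fin d))}

theorem range_vertexBasis (hτ : τ ∈ T.elements) :
    Set.range (T.vertexBasis hτ) = (τ : Set (EuclideanSpace ℝ (Fin d))) :=
  Subtype.range_coe

theorem mem_convexHull_iff (hτ : τ ∈ T.elements) {x : EuclideanSpace ℝ (Fin d)} :
    x ∈ convexHull ℝ (τ : Set (EuclideanSpace ℝ (Fin d))) ↔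
      ∀ i, 0 ≤ (T.vertexBasis hτ).coord i x := by
  rw [← T.range_vertexBasis hτ, AffineBasis.convexHull_eq_nonneg_coord]
  rfl

theorem mem_interior_iff (hτ : τ ∈ T.elements) {x : EuclideanSpace ℝ (Fin d)} :
    x ∈ interior (convexHull ℝ (τ : Set (EuclideanSpace ℝ (Fin d)))) ↔
      ∀ i, 0 < (T.vertexBasis hτ).coord i x := by
  rw [← T.range_vertexBasis hτ, AffineBasis.interior_convexHull]
  rfl

theorem isCompact_element (τ : Finset (EuclideanSpace ℝ (Fin d))) :
    IsCompact (convexHull ℝ (τ : Set (EuclideanSpace ℝ (Fin d)))) :=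
  τ.finite_toSet.isCompact_convexHull ℝ

theorem measureReal_element_pos (hτ : τ ∈ T.elements) :
    0 < volume.real (convexHull ℝ (τ : Set (EuclideanSpace ℝ (Fin d)))) := by
  refine ENNReal.toReal_pos (ne_of_gt ?_) (isCompact_element τ).measure_lt_top.ne
  refine Measure.measure_pos_of_nonempty_interior _ ⟨Finset.univ.centroid ℝ (T.vertexBasis hτ), ?_⟩
  rw [← T.range_vertexBasis hτ]
  exact (T.vertexBasis hτ).centroid_mem_interior_convexHull

theorem localSize_pos (hd : 1 ≤ d) (hτ : τ ∈ T.elements) : 0 < T.localSize τ := by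
  refine Metric.diam_pos ?_ (isCompact_element τ).isBounded
  have h : 1 < τ.card := by rw [(T.mem_elements.1 hτ).2]; lia
  exact (Finset.one_lt_card_iff_nontrivial.1 h).mono (subset_convexHull ℝ _)

/-- An interior point of an element lies in no other element. -/
theorem eq_of_mem_interior (hτ : τ ∈ T.elements) {σ : Finset (EuclideanSpace ℝ (Fin d))}
    (hσ : σ ∈ T.elements) {x : EuclideanSpace ℝ (Fin d)}
    (hx : x ∈ interior (convexHull ℝ (τ : Set (EuclideanSpace ℝ (Fin d)))))
    (hx' : x ∈ convexHull ℝ (σ : Set (EuclideanSpace ℝ (Fin d)))) : σ = τ := by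
  -- By conformity `x` lies in the hull of the common vertices. If `p` were not among them, its
  -- coordinate would vanish there, but it is positive in the interior of `τ`.
  have hsub : τ ⊆ σ := by
    intro p hp
    by_contra hpσ
    have hx2 := T.inter_subset_convexHull (T.mem_elements.1 hτ).1 (T.mem_elements.1 hσ).1
      ⟨interior_subset hx, hx'⟩
    have hle : convexHull ℝ ((τ : Set (EuclideanSpace ℝ (Fin d))) ∩ σ) ⊆
        (T.vertexBasis hτ).coord ⟨p, hp⟩ ⁻¹' Set.Iic 0 := by
      refine convexHull_min ?_ ((convex_Iic 0).affine_preimage _)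
      rintro q ⟨hqτ, hqσ⟩
      have hne : (⟨p, hp⟩ : τ) ≠ ⟨q, hqτ⟩ := fun h => hpσ (by
        have : p = q := congrArg Subtype.val h
        rw [this]; exact hqσ)
      exact ((T.vertexBasis hτ).coord_apply_ne hne).le
    exact absurd (hle hx2) (not_le.2 ((T.mem_interior_iff hτ).1 hx ⟨p, hp⟩))
  refine (Finset.eq_of_subset_of_card_le hsub ?_).symm
  rw [(T.mem_elements.1 hτ).2, (T.mem_elements.1 hσ).2]

open Classical in
/-- The restriction of the basis function of `p` to the element `τ`, as an affine function. -/
noncomputable def localCoord (T : SimplicialMesh Ω) (τ : Finset (EuclideanSpace ℝ (Fin d)))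
    (p : EuclideanSpace ℝ (Fin d)) : EuclideanSpace ℝ (Fin d) →ᵃ[ℝ] ℝ :=
  if h : ∃ _ : τ ∈ T.elements, p ∈ τ then (T.vertexBasis h.choose).coord ⟨p, h.choose_spec⟩ else 0

theorem localCoord_of_mem (hτ : τ ∈ T.elements) {p : EuclideanSpace ℝ (Fin d)} (hp : p ∈ τ) :
    T.localCoord τ p = (T.vertexBasis hτ).coord ⟨p, hp⟩ :=
  dif_pos (⟨hτ, hp⟩ : ∃ _ : τ ∈ T.elements, p ∈ τ)

theorem localCoord_of_notMem {p : EuclideanSpace ℝ (Fin d)} (hp : p ∉ τ) :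
    T.localCoord τ p = 0 :=
  dif_neg fun h => hp h.choose_spec

theorem continuous_localCoord (p : EuclideanSpace ℝ (Fin d)) : Continuous (T.localCoord τ p) :=
  (T.localCoord τ p).continuous_of_finiteDimensional

theorem localCoord_mem_Icc (hτ : τ ∈ T.elements) (p : EuclideanSpace ℝ (Fin d))
    {x : EuclideanSpace ℝ (Fin d)}
    (hx : x ∈ convexHull ℝ (τ : Set (EuclideanSpace ℝ (Fin d)))) :
    T.localCoord τ p x ∈ Set.Icc (0 : ℝ) 1 := by
  by_cases hp : p ∈ τ
  · rw [T.localCoord_of_mem hτ hp]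
    have h0 := (T.mem_convexHull_iff hτ).1 hx
    refine ⟨h0 _, ?_⟩
    rw [← (T.vertexBasis hτ).sum_coord_apply_eq_one x]
    exact Finset.single_le_sum (fun i _ => h0 i) (Finset.mem_univ (⟨p, hp⟩ : τ))
  · simp [T.localCoord_of_notMem hp]

/-- In the interior of an element the choice hidden in `hat` is forced, by `eq_of_mem_interior`.
Nothing is needed on the faces, which are null sets. -/
theorem hat_eq_localCoord (hτ : τ ∈ T.elements) (p : EuclideanSpace ℝ (Fin d))
    {x : EuclideanSpace ℝ (Fin d)}
    (hx : x ∈ interior (convexHull ℝ (τ : Set (EuclideanSpace ℝ (Fin d))))) :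
    T.hat p x = T.localCoord τ p x := by
  unfold hat
  split_ifs with h
  · have hp := h.choose_spec.choose_spec.1
    have heq := T.eq_of_mem_interior hτ h.choose_spec.choose hx h.choose_spec.choose_spec.2
    rw [← T.localCoord_of_mem h.choose_spec.choose hp, heq]
  · by_cases hp : p ∈ τ
    · exact absurd ⟨τ, hτ, hp, interior_subset hx⟩ h
    · simp [T.localCoord_of_notMem hp]

theorem sizeAt_eq_localSize (hτ : τ ∈ T.elements) {x : EuclideanSpace ℝ (Fin d)}
    (hx : x ∈ interior (convexHull ℝ (τ : Set (EuclideanSpace ℝ (Fin d))))) :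
    T.sizeAt x = T.localSize τ := by
  have h : ∃ σ ∈ T.elements, x ∈ convexHull ℝ (σ : Set (EuclideanSpace ℝ (Fin d))) :=
    ⟨τ, hτ, interior_subset hx⟩
  rw [sizeAt, dif_pos h, T.eq_of_mem_interior hτ h.choose_spec.1 hx h.choose_spec.2]

/-- The constant gradient on the element `τ` of the basis function of `p`. -/
noncomputable def localGradient (T : SimplicialMesh Ω) (τ : Finset (EuclideanSpace ℝ (Fin d)))
    (p : EuclideanSpace ℝ (Fin d)) : EuclideanSpace ℝ (Fin d) :=
  (InnerProductSpace.toDual ℝ _).symm (LinearMap.toContinuousLinearMap (T.localCoord τ p).linear)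

theorem inner_localGradient (p v : EuclideanSpace ℝ (Fin d)) :
    ⟪T.localGradient τ p, v⟫_ℝ = (T.localCoord τ p).linear v := by
  simp [localGradient]

theorem localGradient_of_notMem {p : EuclideanSpace ℝ (Fin d)} (hp : p ∉ τ) :
    T.localGradient τ p = 0 := by
  refine ext_inner_right ℝ fun v => ?_
  simp [T.inner_localGradient, T.localCoord_of_notMem hp]

theorem gradient_hat (hτ : τ ∈ T.elements) (p : EuclideanSpace ℝ (Fin d))
    {x : EuclideanSpace ℝ (Fin d)}
    (hx : x ∈ interior (convexHull ℝ (τ : Set (EuclideanSpace ℝ (Fin d))))) :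
    gradient (T.hat p) x = T.localGradient τ p := by
  refine HasGradientAt.gradient (hasGradientAt_iff_hasFDerivAt.2 ?_)
  rw [localGradient, LinearIsometryEquiv.apply_symm_apply]
  have h := (LinearMap.toContinuousLinearMap (T.localCoord τ p).linear).hasFDerivAt (x := x)
  refine (h.add_const (T.localCoord τ p 0)).congr_of_eventuallyEq ?_
  filter_upwards [isOpen_interior.mem_nhds hx] with y hy
  rw [T.hat_eq_localCoord hτ p hy]
  exact congrFun (T.localCoord τ p).decomp y

/-- The gradient of a basis function is bounded by the reciprocal of an inscribed radius. -/
theorem norm_localGradient_mul_le (hτ : τ ∈ T.elements) (p : EuclideanSpace ℝ (Fin d))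
    {x : EuclideanSpace ℝ (Fin d)} {r : ℝ} (hr : 0 ≤ r)
    (hball : Metric.closedBall x r ⊆ convexHull ℝ (τ : Set (EuclideanSpace ℝ (Fin d)))) :
    ‖T.localGradient τ p‖ * r ≤ 1 := by
  set G := T.localGradient τ p with hG
  rcases eq_or_ne G 0 with h0 | h0
  · simp [h0]
  have hn : ‖G‖ ≠ 0 := norm_ne_zero_iff.2 h0
  -- A step of length `r` in the steepest direction raises the coordinate by `‖G‖ r`, yet both
  -- endpoints have values in `[0, 1]`.
  set v := (r / ‖G‖) • G with hv
  have hvn : ‖v‖ = r := by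
    rw [hv, norm_smul, norm_div, norm_norm, Real.norm_of_nonneg hr, div_mul_cancel₀ _ hn]
  have h1 := T.localCoord_mem_Icc hτ p (hball (show v + x ∈ _ by simp [hvn]))
  have h2 := T.localCoord_mem_Icc hτ p (hball (Metric.mem_closedBall_self hr))
  have h3 := (T.localCoord τ p).map_vadd x v
  rw [vadd_eq_add, vadd_eq_add, ← T.inner_localGradient, ← hG, hv, inner_smul_right,
    real_inner_self_eq_norm_sq, ← hv] at h3
  have h4 : r / ‖G‖ * ‖G‖ ^ 2 = ‖G‖ * r := by field_simp
  rw [h4] at h3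
  linarith [h1.2, h2.1]

theorem exists_mem_elements {p : EuclideanSpace ℝ (Fin d)} (hp : p ∈ T.interiorNodes) :
    ∃ τ ∈ T.elements, p ∈ τ := by
  have hp' : {p} ∈ T.faces := by
    simp only [interiorNodes, Finset.mem_filter, Set.Finite.mem_toFinset] at hp
    exact hp.1
  obtain ⟨τ, hτ, hsub, hcard⟩ := T.pure _ hp'
  exact ⟨τ, T.mem_elements.2 ⟨hτ, hcard⟩, hsub (Finset.mem_singleton_self p)⟩

theorem exists_element_of_mem {x : EuclideanSpace ℝ (Fin d)} (hx : x ∈ Ω) :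
    ∃ τ ∈ T.elements, x ∈ convexHull ℝ (τ : Set (EuclideanSpace ℝ (Fin d))) := by
  have h : x ∈ T.space := T.cover ▸ subset_closure hx
  obtain ⟨s, hs, hxs⟩ := Geometry.SimplicialComplex.mem_space_iff.1 h
  obtain ⟨τ, hτ, hsub, hcard⟩ := T.pure _ hs
  exact ⟨τ, T.mem_elements.2 ⟨hτ, hcard⟩, convexHull_mono (Finset.coe_subset.2 hsub) hxs⟩

/-- This is where `Ω` must be the interior of its closure: a slit removed from `Ω` could otherwise
cut through an element. -/
theorem interior_element_subset (hΩ : interior (closure Ω) = Ω) (hτ : τ ∈ T.elements) :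
    interior (convexHull ℝ (τ : Set (EuclideanSpace ℝ (Fin d)))) ⊆ Ω := by
  rw [← hΩ, ← T.cover]
  exact interior_mono (Geometry.SimplicialComplex.convexHull_subset_space (T.mem_elements.1 hτ).1)

/-- Element by element integration over `Ω`. -/
theorem setIntegral_eq_sum_elements (hΩ : interior (closure Ω) = Ω)
    {f : EuclideanSpace ℝ (Fin d) → ℝ}
    {g : Finset (EuclideanSpace ℝ (Fin d)) → EuclideanSpace ℝ (Fin d) → ℝ}
    (hg : ∀ τ ∈ T.elements, Continuous (g τ))
    (hfg : ∀ τ ∈ T.elements,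
      ∀ x ∈ interior (convexHull ℝ (τ : Set (EuclideanSpace ℝ (Fin d)))), f x = g τ x) :
    ∫ x in Ω, f x = ∑ τ ∈ T.elements,
      ∫ x in convexHull ℝ (τ : Set (EuclideanSpace ℝ (Fin d))), g τ x := by
  have hfr : ∀ τ : Finset (EuclideanSpace ℝ (Fin d)),
      volume (frontier (convexHull ℝ (τ : Set (EuclideanSpace ℝ (Fin d))))) = 0 := fun τ =>
    (convex_convexHull ℝ _).addHaar_frontier volume
  -- The open elements exhaust `Ω` up to the frontiers of finitely many convex sets, which are null.
  have hae : (⋃ τ ∈ T.elements, interior (convexHull ℝ (τ : Set (EuclideanSpace ℝ (Fin d)))))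
      =ᵐ[volume] Ω := by
    refine Filter.EventuallyLE.antisymm (LE.le.eventuallyLE
      (Set.iUnion₂_subset fun τ hτ => T.interior_element_subset hΩ hτ)) ?_
    rw [ae_le_set]
    refine measure_mono_null (t := ⋃ τ ∈ T.elements,
      frontier (convexHull ℝ (τ : Set (EuclideanSpace ℝ (Fin d))))) ?_
      ((measure_biUnion_null_iff T.elements.countable_toSet).2 fun τ _ => hfr τ)
    rintro x ⟨hxΩ, hx⟩
    obtain ⟨τ, hτ, hxτ⟩ := T.exists_element_of_mem hxΩ
    refine Set.mem_biUnion hτ ⟨subset_closure hxτ, fun hxi => hx (Set.mem_biUnion hτ hxi)⟩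
  rw [← setIntegral_congr_set hae, integral_biUnion_finset]
  · refine Finset.sum_congr rfl fun τ hτ => ?_
    rw [setIntegral_congr_fun isOpen_interior.measurableSet (hfg τ hτ)]
    refine setIntegral_congr_set ?_
    exact interior_ae_eq_of_null_frontier (hfr τ)
  · exact fun τ _ => isOpen_interior.measurableSet
  · intro τ hτ σ hσ hne
    refine Set.disjoint_left.2 fun x hx hx' => hne ?_
    exact (T.eq_of_mem_interior hτ hσ hx (interior_subset hx')).symm
  · intro τ hτ
    refine IntegrableOn.congr_fun ?_ (fun x hx => (hfg τ hτ x hx).symm)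
      isOpen_interior.measurableSet
    exact ((hg τ hτ).continuousOn.integrableOn_compact (isCompact_element τ)).mono_set
      interior_subset

end SimplicialMesh

/-! ### Weighted sums of quadratic forms. -/

section SumsOfForms

theorem isHermitian_sum_smul {n κ : Type*} (s : Finset κ) (w : κ → ℝ) {A : κ → Matrix n n ℝ}
    (hA : ∀ k ∈ s, (A k).IsHermitian) : (∑ k ∈ s, w k • A k).IsHermitian := by
  classical
  induction s using Finset.induction_on with
  | empty => simp
  | insert a s ha ih =>
    rw [Finset.sum_insert ha]
    exact ((hA a (Finset.mem_insert_self a s)).smul (IsSelfAdjoint.all (w a))).add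
      (ih fun k hk => hA k (Finset.mem_insert_of_mem hk))

variable {n κ : Type*} [Fintype n]

theorem sum_smul_mulVec_dotProduct (s : Finset κ) (w : κ → ℝ) (A : κ → Matrix n n ℝ)
    (y z : n → ℝ) :
    ((∑ k ∈ s, w k • A k) *ᵥ y) ⬝ᵥ z = ∑ k ∈ s, w k * ((A k *ᵥ y) ⬝ᵥ z) := by
  simp only [Matrix.sum_mulVec, Matrix.smul_mulVec, sum_dotProduct, smul_dotProduct, smul_eq_mul]

theorem lump_sum_smul (s : Finset κ) (w : κ → ℝ) (A : κ → Matrix n n ℝ) :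
    lump (∑ k ∈ s, w k • A k) = ∑ k ∈ s, w k • lump (A k) := by
  classical
  ext i j
  simp only [lump, Matrix.diagonal_apply, Matrix.sum_apply, Matrix.smul_apply]
  split_ifs with h
  · simp only [smul_eq_mul, Finset.mul_sum]
    exact Finset.sum_comm
  · simp

end SumsOfForms

/-! ### Element matrices and the local inverse inequality. -/

namespace SimplicialMesh

variable {d : ℕ} {Ω : Set (EuclideanSpace ℝ (Fin d))} (T : SimplicialMesh Ω)
  {τ : Finset (EuclideanSpace ℝ (Fin d))}

/-- The constant `|τ| / ((d + 1) (d + 2))` in the local mass matrix. -/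
noncomputable def massFactor (_ : SimplicialMesh Ω) (τ : Finset (EuclideanSpace ℝ (Fin d))) : ℝ :=
  volume.real (convexHull ℝ (τ : Set (EuclideanSpace ℝ (Fin d)))) / ((d + 1) * (d + 2))

open Classical in
/-- The interior nodes among the vertices of `τ`. -/
noncomputable def localNodes (T : SimplicialMesh Ω) (τ : Finset (EuclideanSpace ℝ (Fin d))) :
    Finset T.interiorNodes :=
  Finset.univ.filter fun i => (i : EuclideanSpace ℝ (Fin d)) ∈ τ

open Classical in
/-- The contribution of the element `τ` to the mass matrix. -/
noncomputable def localMass (T : SimplicialMesh Ω) (τ : Finset (EuclideanSpace ℝ (Fin d))) :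
    Matrix T.interiorNodes T.interiorNodes ℝ :=
  Matrix.of fun j i => if i ∈ T.localNodes τ ∧ j ∈ T.localNodes τ then
    T.massFactor τ * (1 + if i = j then 1 else 0) else 0

/-- The contribution of the element `τ` to the stiffness matrix. -/
noncomputable def localStiffness (T : SimplicialMesh Ω) (τ : Finset (EuclideanSpace ℝ (Fin d))) :
    Matrix T.interiorNodes T.interiorNodes ℝ :=
  Matrix.of fun j i => volume.real (convexHull ℝ (τ : Set (EuclideanSpace ℝ (Fin d)))) *
    ⟪T.localGradient τ i, T.localGradient τ j⟫_ℝ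

theorem mem_localNodes {i : T.interiorNodes} :
    i ∈ T.localNodes τ ↔ (i : EuclideanSpace ℝ (Fin d)) ∈ τ := by
  simp [localNodes]

theorem massFactor_pos (hτ : τ ∈ T.elements) : 0 < T.massFactor τ :=
  div_pos (T.measureReal_element_pos hτ) (by positivity)

/-- Only an inequality, because vertices of `τ` outside `Ω` carry no degree of freedom. -/
theorem card_localNodes_le (hτ : τ ∈ T.elements) : (T.localNodes τ).card ≤ d + 1 := by
  rw [← (T.mem_elements.1 hτ).2]
  exact Finset.card_le_card_of_injOn (fun i => (i : EuclideanSpace ℝ (Fin d)))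
    (fun i hi => T.mem_localNodes.1 hi) Subtype.val_injective.injOn

theorem setIntegral_localCoord_mul (hτ : τ ∈ T.elements) (i j : T.interiorNodes) :
    ∫ x in convexHull ℝ (τ : Set (EuclideanSpace ℝ (Fin d))),
      T.localCoord τ i x * T.localCoord τ j x = T.localMass τ j i := by
  classical
  simp only [localMass, Matrix.of_apply, T.mem_localNodes]
  split_ifs with h hij
  · subst hij
    have hi := h.1
    have := (T.vertexBasis hτ).setIntegral_coord_mul_coord volume ⟨i, hi⟩ ⟨i, hi⟩
    rw [T.range_vertexBasis hτ, Fintype.card_coe, (T.mem_elements.1 hτ).2] at this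
    rw [T.localCoord_of_mem hτ hi, this, massFactor, if_pos rfl]
    push_cast
    ring
  · have hne : (⟨i, h.1⟩ : τ) ≠ ⟨j, h.2⟩ := fun he =>
      hij (Subtype.ext (Subtype.mk.inj he))
    have := (T.vertexBasis hτ).setIntegral_coord_mul_coord volume ⟨i, h.1⟩ ⟨j, h.2⟩
    rw [T.range_vertexBasis hτ, Fintype.card_coe, (T.mem_elements.1 hτ).2] at this
    rw [T.localCoord_of_mem hτ h.1, T.localCoord_of_mem hτ h.2, this, massFactor,
      if_neg hne]
    push_cast
    ring
  · rcases not_and_or.1 h with h | h <;> simp [T.localCoord_of_notMem h]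

theorem weightedMass_eq_sum (hΩ : interior (closure Ω) = Ω)
    {w : EuclideanSpace ℝ (Fin d) → ℝ} {ω : Finset (EuclideanSpace ℝ (Fin d)) → ℝ}
    (hw : ∀ τ ∈ T.elements,
      ∀ x ∈ interior (convexHull ℝ (τ : Set (EuclideanSpace ℝ (Fin d)))), w x = ω τ) :
    T.weightedMass w = ∑ τ ∈ T.elements, ω τ • T.localMass τ := by
  ext j i
  rw [weightedMass, Matrix.of_apply, Matrix.sum_apply, T.setIntegral_eq_sum_elements hΩ
    (g := fun τ x => ω τ * (T.localCoord τ i x * T.localCoord τ j x))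
    (fun τ _ => continuous_const.mul ((T.continuous_localCoord _).mul (T.continuous_localCoord _)))
    fun τ hτ x hx => by
      rw [hw τ hτ x hx, T.hat_eq_localCoord hτ _ hx, T.hat_eq_localCoord hτ _ hx]]
  refine Finset.sum_congr rfl fun τ hτ => ?_
  rw [integral_const_mul, T.setIntegral_localCoord_mul hτ, Matrix.smul_apply, smul_eq_mul]

theorem weightedStiffness_eq_sum (hΩ : interior (closure Ω) = Ω)
    {w : EuclideanSpace ℝ (Fin d) → ℝ} {ω : Finset (EuclideanSpace ℝ (Fin d)) → ℝ}
    (hw : ∀ τ ∈ T.elements,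
      ∀ x ∈ interior (convexHull ℝ (τ : Set (EuclideanSpace ℝ (Fin d)))), w x = ω τ) :
    T.weightedStiffness w = ∑ τ ∈ T.elements, ω τ • T.localStiffness τ := by
  ext j i
  rw [weightedStiffness, Matrix.of_apply, Matrix.sum_apply, T.setIntegral_eq_sum_elements hΩ
    (g := fun τ _ => ω τ * ⟪T.localGradient τ i, T.localGradient τ j⟫_ℝ)
    (fun τ _ => continuous_const)
    fun τ hτ x hx => by
      rw [hw τ hτ x hx, T.gradient_hat hτ _ hx, T.gradient_hat hτ _ hx]]
  refine Finset.sum_congr rfl fun τ hτ => ?_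
  rw [setIntegral_const, Matrix.smul_apply, localStiffness, Matrix.of_apply, smul_eq_mul,
    smul_eq_mul]
  ring

theorem isHermitian_localMass (τ : Finset (EuclideanSpace ℝ (Fin d))) :
    (T.localMass τ).IsHermitian := by
  refine Matrix.IsHermitian.ext fun i j => ?_
  simp only [localMass, Matrix.of_apply, star_trivial, and_comm, eq_comm]

theorem localMass_nonneg (hτ : τ ∈ T.elements) (i j : T.interiorNodes) :
    0 ≤ T.localMass τ i j := by
  have := (T.massFactor_pos hτ).le
  simp only [localMass, Matrix.of_apply]
  split_ifs <;> positivity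

/-- On the local nodes the matrix is a multiple of the identity plus the rank-one all-ones matrix.
-/
theorem localMass_form (y : T.interiorNodes → ℝ) :
    (T.localMass τ *ᵥ y) ⬝ᵥ y = T.massFactor τ *
      (∑ i ∈ T.localNodes τ, y i ^ 2 + (∑ i ∈ T.localNodes τ, y i) ^ 2) := by
  classical
  have h1 : ∀ j, (T.localMass τ *ᵥ y) j = if j ∈ T.localNodes τ then
      T.massFactor τ * (∑ i ∈ T.localNodes τ, y i + y j) else 0 := by
    intro j
    simp only [Matrix.mulVec, dotProduct, localMass, Matrix.of_apply]
    split_ifs with hj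
    · have : ∀ i, (if i ∈ T.localNodes τ ∧ True then
          T.massFactor τ * (1 + if i = j then (1 : ℝ) else 0) else 0) * y i =
          if i ∈ T.localNodes τ then
            T.massFactor τ * (y i + if i = j then y i else 0) else 0 := fun i => by
        by_cases hi : i ∈ T.localNodes τ
        · simp only [hi, and_self, if_true, mul_assoc, add_mul, one_mul, ite_mul, zero_mul]
        · simp [hi]
      simp only [hj, this]
      rw [Finset.sum_ite_mem, Finset.univ_inter, ← Finset.mul_sum, Finset.sum_add_distrib,
        Finset.sum_ite_eq' _ j, if_pos hj]
    · simp [hj]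
  simp only [dotProduct, h1, ite_mul, zero_mul]
  rw [Finset.sum_ite_mem, Finset.univ_inter, sq (∑ i ∈ T.localNodes τ, y i), Finset.mul_sum,
    ← Finset.sum_add_distrib, Finset.mul_sum]
  exact Finset.sum_congr rfl fun i _ => by ring

theorem massFactor_mul_le_localMass_form (hτ : τ ∈ T.elements) (y : T.interiorNodes → ℝ) :
    T.massFactor τ * ∑ i ∈ T.localNodes τ, y i ^ 2 ≤ (T.localMass τ *ᵥ y) ⬝ᵥ y := by
  rw [localMass_form]
  exact mul_le_mul_of_nonneg_left (le_add_of_nonneg_right (sq_nonneg _)) (T.massFactor_pos hτ).le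

/-- The source of the constant `d + 2`: with `m ≤ d + 1` interior nodes, each nonzero row sum is `m
+ 1` times the mass factor. -/
theorem lump_localMass_form_le (hτ : τ ∈ T.elements) (y : T.interiorNodes → ℝ) :
    (lump (T.localMass τ) *ᵥ y) ⬝ᵥ y ≤ (d + 2) * ((T.localMass τ *ᵥ y) ⬝ᵥ y) := by
  classical
  have hrow : ∀ j, ∑ i, T.localMass τ j i = if j ∈ T.localNodes τ then
      T.massFactor τ * ((T.localNodes τ).card + 1) else 0 := by
    intro j
    simp only [localMass, Matrix.of_apply]
    by_cases hj : j ∈ T.localNodes τ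
    · simp only [hj, and_true, if_true]
      rw [Finset.sum_ite_mem, Finset.univ_inter, ← Finset.mul_sum, Finset.sum_add_distrib,
        Finset.sum_ite_eq' _ j, if_pos hj]
      simp
    · simp [hj]
  have h1 : (lump (T.localMass τ) *ᵥ y) ⬝ᵥ y =
      ((T.localNodes τ).card + 1) * (T.massFactor τ * ∑ i ∈ T.localNodes τ, y i ^ 2) := by
    simp only [lump, Matrix.mulVec_diagonal, dotProduct, hrow, ite_mul, zero_mul]
    rw [Finset.sum_ite_mem, Finset.univ_inter, Finset.mul_sum, Finset.mul_sum]
    exact Finset.sum_congr rfl fun i _ => by ring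
  have hcard : ((T.localNodes τ).card : ℝ) ≤ d + 1 := by exact_mod_cast T.card_localNodes_le hτ
  rw [h1]
  refine mul_le_mul (by linarith) (T.massFactor_mul_le_localMass_form hτ y) ?_ (by positivity)
  exact mul_nonneg (T.massFactor_pos hτ).le (Finset.sum_nonneg fun i _ => sq_nonneg _)

/-- The finite element function `∑ yᵢ φᵢ` has a constant gradient on `τ`. -/
theorem localStiffness_form (y : T.interiorNodes → ℝ) :
    (T.localStiffness τ *ᵥ y) ⬝ᵥ y =
      volume.real (convexHull ℝ (τ : Set (EuclideanSpace ℝ (Fin d)))) *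
        ‖∑ i, y i • T.localGradient τ i‖ ^ 2 := by
  rw [← real_inner_self_eq_norm_sq, inner_sum]
  simp only [sum_inner, inner_smul_left, inner_smul_right, Matrix.mulVec, dotProduct,
    localStiffness, Matrix.of_apply, Finset.mul_sum, Finset.sum_mul, conj_trivial]
  exact Finset.sum_congr rfl fun i _ => Finset.sum_congr rfl fun j _ => by ring

theorem posSemidef_localStiffness (τ : Finset (EuclideanSpace ℝ (Fin d))) :
    (T.localStiffness τ).PosSemidef := by
  refine Matrix.posSemidef_of_mulVec_dotProduct_nonneg (Matrix.IsHermitian.ext fun i j => ?_)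
    fun y => ?_
  · simp only [localStiffness, Matrix.of_apply, star_trivial, real_inner_comm]
  · rw [localStiffness_form]
    positivity

/-- The constant of the local inverse inequality on shape regular meshes. -/
noncomputable def inverseConst (d : ℕ) (γ : ℝ) : ℝ := (d + 1) ^ 2 * (d + 2) / γ ^ 2

theorem inverseConst_pos (d : ℕ) {γ : ℝ} (hγ : 0 < γ) : 0 < inverseConst d γ := by
  unfold inverseConst
  positivity

/-- The local inverse inequality. -/
theorem localSize_sq_mul_localStiffness_form_le {γ : ℝ} (hγ : 0 < γ)
    (hT : T.ShapeRegular γ) (hd : 1 ≤ d) (hτ : τ ∈ T.elements) (y : T.interiorNodes → ℝ) :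
    T.localSize τ ^ 2 * ((T.localStiffness τ *ᵥ y) ⬝ᵥ y) ≤
      inverseConst d γ * ((T.localMass τ *ᵥ y) ⬝ᵥ y) := by
  classical
  have hh := T.localSize_pos hd hτ
  obtain ⟨x, hx⟩ := hT τ hτ
  have hr : 0 < γ * T.localSize τ := mul_pos hγ hh
  have hsum : ∑ i, y i • T.localGradient τ i =
      ∑ i ∈ T.localNodes τ, y i • T.localGradient τ i := by
    refine (Finset.sum_subset (Finset.subset_univ _) fun i _ hi => ?_).symm
    rw [T.localGradient_of_notMem fun h => hi (T.mem_localNodes.2 h), smul_zero]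
  have h1 : ‖∑ i, y i • T.localGradient τ i‖ * (γ * T.localSize τ) ≤
      ∑ i ∈ T.localNodes τ, |y i| := by
    rw [hsum]
    refine (mul_le_mul_of_nonneg_right (norm_sum_le _ _) hr.le).trans ?_
    rw [Finset.sum_mul]
    refine Finset.sum_le_sum fun i _ => ?_
    rw [norm_smul, mul_assoc, Real.norm_eq_abs]
    exact mul_le_of_le_one_right (abs_nonneg _)
      (T.norm_localGradient_mul_le hτ i hr.le hx)
  -- Cauchy–Schwarz costs one factor `d + 1`. The remaining `(d + 1) (d + 2)` in `inverseConst` is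
  -- the ratio of the volume to the mass factor.
  have h2 : (∑ i ∈ T.localNodes τ, |y i|) ^ 2 ≤ (d + 1) * ∑ i ∈ T.localNodes τ, y i ^ 2 := by
    refine sq_sum_le_card_mul_sum_sq.trans ?_
    simp only [sq_abs]
    refine mul_le_mul_of_nonneg_right ?_ (Finset.sum_nonneg fun i _ => sq_nonneg _)
    exact_mod_cast T.card_localNodes_le hτ
  have h3 := (pow_le_pow_left₀ (by positivity) h1 2).trans h2
  rw [mul_pow, mul_pow] at h3
  have h4 := T.massFactor_mul_le_localMass_form hτ y
  have hV : volume.real (convexHull ℝ (τ : Set (EuclideanSpace ℝ (Fin d)))) =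
      T.massFactor τ * ((d + 1) * (d + 2)) := by
    rw [massFactor, div_mul_cancel₀ _ (by positivity)]
  have hm := T.massFactor_pos hτ
  rw [localStiffness_form, hV, inverseConst, div_mul_eq_mul_div, le_div_iff₀ (by positivity)]
  calc _ = T.massFactor τ * ((d + 1) * (d + 2)) *
        (‖∑ i, y i • T.localGradient τ i‖ ^ 2 * (γ ^ 2 * T.localSize τ ^ 2)) := by ring
    _ ≤ T.massFactor τ * ((d + 1) * (d + 2)) * ((d + 1) * ∑ i ∈ T.localNodes τ, y i ^ 2) :=
        mul_le_mul_of_nonneg_left h3 (by positivity)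
    _ = (d + 1) ^ 2 * (d + 2) * (T.massFactor τ * ∑ i ∈ T.localNodes τ, y i ^ 2) := by ring
    _ ≤ _ := mul_le_mul_of_nonneg_left h4 (by positivity)

end SimplicialMesh

/-! ### Assembly, spectral equivalence and global inverse inequalities. -/

namespace SimplicialMesh

variable {d : ℕ} {Ω : Set (EuclideanSpace ℝ (Fin d))} (T : SimplicialMesh Ω)

theorem mass_eq_sum (hΩ : interior (closure Ω) = Ω) :
    T.mass = ∑ τ ∈ T.elements, (1 : ℝ) • T.localMass τ :=
  T.weightedMass_eq_sum hΩ (ω := fun _ => 1) fun _ _ _ _ => rfl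

theorem weightedMass_inv_eq_sum (hΩ : interior (closure Ω) = Ω) :
    (T.weightedMass fun x => 1 / T.sizeAt x ^ 4) =
      ∑ τ ∈ T.elements, (1 / T.localSize τ ^ 4) • T.localMass τ :=
  T.weightedMass_eq_sum hΩ (ω := fun τ => 1 / T.localSize τ ^ 4)
    fun τ hτ x hx => by rw [T.sizeAt_eq_localSize hτ hx]

theorem stiffness_eq_sum (hΩ : interior (closure Ω) = Ω) :
    T.stiffness = ∑ τ ∈ T.elements, (1 : ℝ) • T.localStiffness τ :=
  T.weightedStiffness_eq_sum hΩ (ω := fun _ => 1) fun _ _ _ _ => rfl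

theorem weightedStiffness_size_eq_sum (hΩ : interior (closure Ω) = Ω) :
    (T.weightedStiffness fun x => T.sizeAt x ^ 2) =
      ∑ τ ∈ T.elements, T.localSize τ ^ 2 • T.localStiffness τ :=
  T.weightedStiffness_eq_sum hΩ (ω := fun τ => T.localSize τ ^ 2)
    fun τ hτ x hx => by rw [T.sizeAt_eq_localSize hτ hx]

/-- If `y i ≠ 0`, any element containing node `i` contributes strictly; purity of the complex
supplies one. -/
theorem posDef_sum_localMass {ω : Finset (EuclideanSpace ℝ (Fin d)) → ℝ}
    (hω : ∀ τ ∈ T.elements, 0 < ω τ) :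
    (∑ τ ∈ T.elements, ω τ • T.localMass τ).PosDef := by
  refine Matrix.posDef_of_mulVec_dotProduct_pos
    (isHermitian_sum_smul _ _ fun τ _ => T.isHermitian_localMass τ) fun y hy => ?_
  obtain ⟨i, hi⟩ := Function.ne_iff.1 hy
  obtain ⟨τ, hτ, hiτ⟩ := T.exists_mem_elements i.2
  rw [sum_smul_mulVec_dotProduct]
  have hnonneg : ∀ σ, 0 ≤ ∑ i ∈ T.localNodes σ, y i ^ 2 := fun σ =>
    Finset.sum_nonneg fun i _ => sq_nonneg _
  refine Finset.sum_pos' (fun σ hσ => mul_nonneg (hω σ hσ).le ?_)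
    ⟨τ, hτ, mul_pos (hω τ hτ) ?_⟩
  · exact (mul_nonneg (T.massFactor_pos hσ).le (hnonneg σ)).trans
      (T.massFactor_mul_le_localMass_form hσ y)
  · refine (mul_pos (T.massFactor_pos hτ) ?_).trans_le (T.massFactor_mul_le_localMass_form hτ y)
    exact Finset.sum_pos' (fun i _ => sq_nonneg _)
      ⟨i, T.mem_localNodes.2 hiτ, by have : y i ≠ 0 := hi; positivity⟩

theorem posSemidef_sum_localStiffness {ω : Finset (EuclideanSpace ℝ (Fin d)) → ℝ}
    (hω : ∀ τ ∈ T.elements, 0 ≤ ω τ) :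
    (∑ τ ∈ T.elements, ω τ • T.localStiffness τ).PosSemidef := by
  refine Matrix.posSemidef_of_mulVec_dotProduct_nonneg
    (isHermitian_sum_smul _ _ fun τ _ => (T.posSemidef_localStiffness τ).isHermitian) fun y => ?_
  rw [sum_smul_mulVec_dotProduct]
  exact Finset.sum_nonneg fun τ hτ =>
    mul_nonneg (hω τ hτ) ((T.posSemidef_localStiffness τ).mulVec_dotProduct_nonneg y)

theorem posDef_mass (hΩ : interior (closure Ω) = Ω) : T.mass.PosDef := by
  rw [T.mass_eq_sum hΩ]
  exact T.posDef_sum_localMass fun _ _ => one_pos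

theorem posDef_weightedMass_inv (hd : 1 ≤ d) (hΩ : interior (closure Ω) = Ω) :
    (T.weightedMass fun x => 1 / T.sizeAt x ^ 4).PosDef := by
  rw [T.weightedMass_inv_eq_sum hΩ]
  exact T.posDef_sum_localMass fun τ hτ => one_div_pos.2 (pow_pos (T.localSize_pos hd hτ) 4)

theorem posSemidef_stiffness (hΩ : interior (closure Ω) = Ω) : T.stiffness.PosSemidef := by
  rw [T.stiffness_eq_sum hΩ]
  exact T.posSemidef_sum_localStiffness fun _ _ => zero_le_one

theorem posSemidef_regMatrix (hd : 1 ≤ d) (hΩ : interior (closure Ω) = Ω) (r : Regularization) :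
    (T.regMatrix r).PosSemidef := by
  have hK := T.posSemidef_stiffness hΩ
  cases r with
  | constantHMinusOne => exact hK.smul (sq_nonneg _)
  | variableHMinusOne =>
    rw [regMatrix, T.weightedStiffness_size_eq_sum hΩ]
    exact T.posSemidef_sum_localStiffness fun _ _ => sq_nonneg _
  | constantLTwo =>
    exact ((T.posDef_mass hΩ).posSemidef_mul_inv_mul hK.isHermitian).smul
      (Even.pow_nonneg (by decide) _)
  | variableLTwo =>
    exact (T.posDef_weightedMass_inv hd hΩ).posSemidef_mul_inv_mul hK.isHermitian

theorem lump_mass_form_le (hΩ : interior (closure Ω) = Ω) (y : T.interiorNodes → ℝ) :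
    (lump T.mass *ᵥ y) ⬝ᵥ y ≤ (d + 2) * ((T.mass *ᵥ y) ⬝ᵥ y) := by
  rw [T.mass_eq_sum hΩ, lump_sum_smul, sum_smul_mulVec_dotProduct, sum_smul_mulVec_dotProduct,
    Finset.mul_sum]
  refine Finset.sum_le_sum fun τ hτ => ?_
  rw [one_mul, one_mul]
  exact T.lump_localMass_form_le hτ y

theorem mass_form_le_lump (hΩ : interior (closure Ω) = Ω) (y : T.interiorNodes → ℝ) :
    (T.mass *ᵥ y) ⬝ᵥ y ≤ (lump T.mass *ᵥ y) ⬝ᵥ y := by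
  refine mulVec_dotProduct_le_lump (T.posDef_mass hΩ).isHermitian (fun i j => ?_) y
  rw [T.mass_eq_sum hΩ, Matrix.sum_apply]
  refine Finset.sum_nonneg fun τ hτ => ?_
  rw [Matrix.smul_apply, one_smul]
  exact T.localMass_nonneg hτ i j

theorem spectrallyEquivalent_schur (hd : 1 ≤ d) (hΩ : interior (closure Ω) = Ω)
    (r : Regularization) {c : ℝ}
    (h : ∀ y, (T.regMatrix r *ᵥ y) ⬝ᵥ y ≤ c ^ 2 * ((T.mass *ᵥ y) ⬝ᵥ y)) :
    SpectrallyEquivalent (1 / ((d : ℝ) + 2)) (1 + c ^ 2) (lump T.mass) (T.schur r) := by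
  intro y
  have h1 := T.lump_mass_form_le hΩ y
  have h2 := T.mass_form_le_lump hΩ y
  have h3 := (T.posSemidef_regMatrix hd hΩ r).mulVec_dotProduct_nonneg y
  rw [schur, Matrix.add_mulVec, add_dotProduct]
  constructor
  · rw [one_div_mul_eq_div, div_le_iff₀ (by positivity)]
    nlinarith [Nat.cast_nonneg (α := ℝ) d]
  · have h4 := h y
    have h5 := mul_le_mul_of_nonneg_left h2 (add_nonneg zero_le_one (sq_nonneg c))
    linarith

section InverseInequalities

variable {T} {γ : ℝ}

theorem weightedStiffness_size_form_le (hd : 1 ≤ d) (hΩ : interior (closure Ω) = Ω)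
    (hγ : 0 < γ) (hT : T.ShapeRegular γ) (y : T.interiorNodes → ℝ) :
    ((T.weightedStiffness fun x => T.sizeAt x ^ 2) *ᵥ y) ⬝ᵥ y ≤
      inverseConst d γ * ((T.mass *ᵥ y) ⬝ᵥ y) := by
  rw [T.mass_eq_sum hΩ, T.weightedStiffness_size_eq_sum hΩ, sum_smul_mulVec_dotProduct,
    sum_smul_mulVec_dotProduct, Finset.mul_sum]
  refine Finset.sum_le_sum fun τ hτ => ?_
  rw [one_mul]
  exact T.localSize_sq_mul_localStiffness_form_le hγ hT hd hτ y

/-- Duality replaces the inverse of the global weighted mass matrix by an inequality between sums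
over elements, which is then proved term by term. -/
theorem regMatrix_variableLTwo_form_le (hd : 1 ≤ d) (hΩ : interior (closure Ω) = Ω)
    (hγ : 0 < γ) (hT : T.ShapeRegular γ) (y : T.interiorNodes → ℝ) :
    (T.regMatrix .variableLTwo *ᵥ y) ⬝ᵥ y ≤
      inverseConst d γ ^ 2 * ((T.mass *ᵥ y) ⬝ᵥ y) := by
  have hC := inverseConst_pos d hγ
  refine (T.posDef_weightedMass_inv hd hΩ).mul_inv_mul_form_le
    (T.posSemidef_stiffness hΩ).isHermitian (fun y z => ?_) y
  rw [T.mass_eq_sum hΩ, T.stiffness_eq_sum hΩ, T.weightedMass_inv_eq_sum hΩ,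
    sum_smul_mulVec_dotProduct, sum_smul_mulVec_dotProduct, sum_smul_mulVec_dotProduct,
    Finset.mul_sum, Finset.mul_sum, ← Finset.sum_add_distrib]
  refine Finset.sum_le_sum fun τ hτ => ?_
  have hh := T.localSize_pos hd hτ
  -- With `C = inverseConst d γ`, the weights are chosen so that the inverse inequality turns the
  -- `z` term into exactly `h_τ⁻⁴ (M_τ z, z)` and the `y` term into `C² (M_τ y, y)`.
  have hk := (T.posSemidef_localStiffness τ).two_mul_form_le
    (α := 1 / (inverseConst d γ * T.localSize τ ^ 2))
    (β := inverseConst d γ * T.localSize τ ^ 2) (by positivity) (by field_simp) y z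
  have hz := mul_le_mul_of_nonneg_left (T.localSize_sq_mul_localStiffness_form_le hγ hT hd hτ z)
    (show 0 ≤ 1 / (inverseConst d γ * T.localSize τ ^ 4) by positivity)
  have hy := mul_le_mul_of_nonneg_left (T.localSize_sq_mul_localStiffness_form_le hγ hT hd hτ y)
    hC.le
  have e1 : 1 / (inverseConst d γ * T.localSize τ ^ 4) *
      (T.localSize τ ^ 2 * ((T.localStiffness τ *ᵥ z) ⬝ᵥ z)) =
      1 / (inverseConst d γ * T.localSize τ ^ 2) * ((T.localStiffness τ *ᵥ z) ⬝ᵥ z) := by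
    field_simp
  have e2 : 1 / (inverseConst d γ * T.localSize τ ^ 4) *
      (inverseConst d γ * ((T.localMass τ *ᵥ z) ⬝ᵥ z)) =
      1 / T.localSize τ ^ 4 * ((T.localMass τ *ᵥ z) ⬝ᵥ z) := by
    field_simp
  rw [e1, e2] at hz
  rw [one_mul, one_mul]
  linarith

theorem meshSize_nonneg : 0 ≤ T.meshSize :=
  Real.iSup_nonneg fun _ => Metric.diam_nonneg

/-- Quasi-uniformity bounds `h²` by `q² h_τ²` on each element, which reduces the claim to the
variable weight. -/
theorem meshSize_sq_mul_stiffness_form_le (hd : 1 ≤ d) (hΩ : interior (closure Ω) = Ω)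
    (hγ : 0 < γ) (hT : T.ShapeRegular γ) {q : ℝ} (hq : T.QuasiUniform q)
    (y : T.interiorNodes → ℝ) :
    T.meshSize ^ 2 * ((T.stiffness *ᵥ y) ⬝ᵥ y) ≤
      q ^ 2 * inverseConst d γ * ((T.mass *ᵥ y) ⬝ᵥ y) := by
  refine le_trans ?_ ((mul_le_mul_of_nonneg_left
    (weightedStiffness_size_form_le hd hΩ hγ hT y) (sq_nonneg q)).trans_eq (mul_assoc _ _ _).symm)
  rw [T.stiffness_eq_sum hΩ, T.weightedStiffness_size_eq_sum hΩ, sum_smul_mulVec_dotProduct,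
    sum_smul_mulVec_dotProduct, Finset.mul_sum, Finset.mul_sum]
  refine Finset.sum_le_sum fun τ hτ => ?_
  rw [one_mul, ← mul_assoc, ← mul_pow]
  exact mul_le_mul_of_nonneg_right (pow_le_pow_left₀ meshSize_nonneg (hq τ hτ) 2)
    ((T.posSemidef_localStiffness τ).mulVec_dotProduct_nonneg y)

theorem regMatrix_constantLTwo_form_le (hΩ : interior (closure Ω) = Ω) {C : ℝ} (hC : 0 < C)
    (h : ∀ y, T.meshSize ^ 2 * ((T.stiffness *ᵥ y) ⬝ᵥ y) ≤ C * ((T.mass *ᵥ y) ⬝ᵥ y))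
    (y : T.interiorNodes → ℝ) :
    (T.regMatrix .constantLTwo *ᵥ y) ⬝ᵥ y ≤ C ^ 2 * ((T.mass *ᵥ y) ⬝ᵥ y) := by
  have hM := T.posDef_mass hΩ
  have hK := T.posSemidef_stiffness hΩ
  rw [regMatrix, Matrix.smul_mulVec, smul_dotProduct, smul_eq_mul]
  -- The mesh size is `0` when there are no elements, as an empty real supremum. This case is
  -- separated because `h` is inverted below.
  rcases (meshSize_nonneg (T := T)).eq_or_lt with h0 | h0
  · rw [← h0]
    have := hM.posSemidef.mulVec_dotProduct_nonneg y
    simp only [ne_eq, OfNat.ofNat_ne_zero, not_false_eq_true, zero_pow, zero_mul]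
    positivity
  have hb := hM.mul_inv_mul_form_le hK.isHermitian (N := T.mass) (C := C ^ 2 / T.meshSize ^ 4)
    (fun y z => ?_) y
  · refine (mul_le_mul_of_nonneg_left hb (pow_pos h0 4).le).trans_eq ?_
    field_simp
  -- The same Young weights as in the variable case, now with the global `h`; the bound `h` is
  -- applied to the assembled matrices.
  · have hk := hK.two_mul_form_le (α := T.meshSize ^ 2 / C) (β := C / T.meshSize ^ 2)
      (by positivity) (by field_simp) y z
    have hz := mul_le_mul_of_nonneg_left (h z) (show 0 ≤ 1 / C by positivity)
    have hy := mul_le_mul_of_nonneg_left (h y) (show 0 ≤ C / T.meshSize ^ 4 by positivity)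
    have e1 : 1 / C * (T.meshSize ^ 2 * ((T.stiffness *ᵥ z) ⬝ᵥ z)) =
        T.meshSize ^ 2 / C * ((T.stiffness *ᵥ z) ⬝ᵥ z) := by ring
    have e2 : 1 / C * (C * ((T.mass *ᵥ z) ⬝ᵥ z)) = (T.mass *ᵥ z) ⬝ᵥ z := by field_simp
    have e3 : C / T.meshSize ^ 4 * (T.meshSize ^ 2 * ((T.stiffness *ᵥ y) ⬝ᵥ y)) =
        C / T.meshSize ^ 2 * ((T.stiffness *ᵥ y) ⬝ᵥ y) := by field_simp
    have e4 : C / T.meshSize ^ 4 * (C * ((T.mass *ᵥ y) ⬝ᵥ y)) =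
        C ^ 2 / T.meshSize ^ 4 * ((T.mass *ᵥ y) ⬝ᵥ y) := by ring
    rw [e1, e2] at hz
    rw [e3, e4] at hy
    linarith

end InverseInequalities

theorem eigenvalue_le_and_spectrallyEquivalent (hd : 1 ≤ d) (hΩ : interior (closure Ω) = Ω)
    (r : Regularization) {a c : ℝ} (hac : a ≤ c ^ 2)
    (h : ∀ y, (T.regMatrix r *ᵥ y) ⬝ᵥ y ≤ a * ((T.mass *ᵥ y) ⬝ᵥ y)) :
    (∀ μ, IsGenEigenvalue (T.regMatrix r) T.mass μ → μ ≤ c ^ 2) ∧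
      SpectrallyEquivalent (1 / ((d : ℝ) + 2)) (1 + c ^ 2) (lump T.mass) (T.schur r) := by
  have hM := T.posDef_mass hΩ
  have h' : ∀ y, (T.regMatrix r *ᵥ y) ⬝ᵥ y ≤ c ^ 2 * ((T.mass *ᵥ y) ⬝ᵥ y) := fun y =>
    (h y).trans (mul_le_mul_of_nonneg_right hac (hM.posSemidef.mulVec_dotProduct_nonneg y))
  exact ⟨fun μ hμ => hμ.le hM h', T.spectrallyEquivalent_schur hd hΩ r h'⟩

end SimplicialMesh

theorem mainTheorem10 (d : ℕ) (hd : 1 ≤ d) (hd' : d ≤ 3) :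
    -- for every mesh: the mass matrices are positive definite (hence invertible), the largest
    -- generalized eigenvalue exists, and every upper bound `c²` of it gives the inequalities
    (∀ (Ω : Set (EuclideanSpace ℝ (Fin d))), IsOpen Ω → interior (closure Ω) = Ω →
      ∀ T : SimplicialMesh Ω,
        T.mass.PosDef ∧ (T.weightedMass fun x => 1 / T.sizeAt x ^ 4).PosDef ∧
        ∀ r : Regularization,
          (T.interiorNodes.Nonempty →
            ∃ μ, IsGreatest {μ | IsGenEigenvalue (T.regMatrix r) T.mass μ} μ) ∧
          ∀ c : ℝ, (∀ μ, IsGenEigenvalue (T.regMatrix r) T.mass μ → μ ≤ c ^ 2) →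
            SpectrallyEquivalent (1 / ((d : ℝ) + 2)) (1 + c ^ 2) (lump T.mass) (T.schur r)) ∧
    -- variable regularization: `c` can be chosen uniformly on shape regular meshes
    (∀ γ : ℝ, 0 < γ → ∃ c : ℝ,
      ∀ (Ω : Set (EuclideanSpace ℝ (Fin d))), IsOpen Ω → interior (closure Ω) = Ω →
      ∀ T : SimplicialMesh Ω, T.ShapeRegular γ →
      ∀ r : Regularization, (r = .variableHMinusOne ∨ r = .variableLTwo) →
        (∀ μ, IsGenEigenvalue (T.regMatrix r) T.mass μ → μ ≤ c ^ 2) ∧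
        SpectrallyEquivalent (1 / ((d : ℝ) + 2)) (1 + c ^ 2) (lump T.mass) (T.schur r)) ∧
    -- constant regularization: likewise on shape regular, quasi-uniform meshes
    (∀ γ q : ℝ, 0 < γ → 0 < q → ∃ c : ℝ,
      ∀ (Ω : Set (EuclideanSpace ℝ (Fin d))), IsOpen Ω → interior (closure Ω) = Ω →
      ∀ T : SimplicialMesh Ω, T.ShapeRegular γ → T.QuasiUniform q →
      ∀ r : Regularization, (r = .constantHMinusOne ∨ r = .constantLTwo) →
        (∀ μ, IsGenEigenvalue (T.regMatrix r) T.mass μ → μ ≤ c ^ 2) ∧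
        SpectrallyEquivalent (1 / ((d : ℝ) + 2)) (1 + c ^ 2) (lump T.mass) (T.schur r)) := by
  -- The form bounds are `a` for `H⁻¹` and `a²` for `L²` regularization, with the same `a`; the
  -- choice `c = 1 + a` serves both.
  have hone : ∀ a : ℝ, 0 < a → a ≤ (1 + a) ^ 2 := fun a ha => by nlinarith
  have htwo : ∀ a : ℝ, 0 < a → a ^ 2 ≤ (1 + a) ^ 2 := fun a ha => by nlinarith
  refine ⟨fun Ω _ hΩ T => ⟨T.posDef_mass hΩ, T.posDef_weightedMass_inv hd hΩ, fun r =>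
    ⟨fun hne => ?_, fun c hc => T.spectrallyEquivalent_schur hd hΩ r
      (mulVec_dotProduct_le_of_isGenEigenvalue_le (T.posSemidef_regMatrix hd hΩ r).isHermitian
        (T.posDef_mass hΩ) hc)⟩⟩, fun γ hγ => ?_, fun γ q hγ hq => ?_⟩
  · have : Nonempty T.interiorNodes := hne.to_subtype
    obtain ⟨μ, hμ, -⟩ := exists_isGreatest_isGenEigenvalue
      (T.posSemidef_regMatrix hd hΩ r).isHermitian (T.posDef_mass hΩ)
    exact ⟨μ, hμ⟩
  · have hC := SimplicialMesh.inverseConst_pos d hγ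
    refine ⟨1 + SimplicialMesh.inverseConst d γ, fun Ω _ hΩ T hT r hr => ?_⟩
    rcases hr with rfl | rfl
    · exact T.eigenvalue_le_and_spectrallyEquivalent hd hΩ _ (hone _ hC)
        (SimplicialMesh.weightedStiffness_size_form_le hd hΩ hγ hT)
    · exact T.eigenvalue_le_and_spectrallyEquivalent hd hΩ _ (htwo _ hC)
        (SimplicialMesh.regMatrix_variableLTwo_form_le hd hΩ hγ hT)
  · have hC : 0 < q ^ 2 * SimplicialMesh.inverseConst d γ :=
      mul_pos (pow_pos hq 2) (SimplicialMesh.inverseConst_pos d hγ)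
    refine ⟨1 + q ^ 2 * SimplicialMesh.inverseConst d γ, fun Ω _ hΩ T hT hqT r hr => ?_⟩
    have hK := SimplicialMesh.meshSize_sq_mul_stiffness_form_le hd hΩ hγ hT hqT
    rcases hr with rfl | rfl
    · refine T.eigenvalue_le_and_spectrallyEquivalent hd hΩ _ (hone _ hC) fun y => ?_
      rw [SimplicialMesh.regMatrix, Matrix.smul_mulVec, smul_dotProduct, smul_eq_mul]
      exact hK y
    · exact T.eigenvalue_le_and_spectrallyEquivalent hd hΩ _ (htwo _ hC)
        (SimplicialMesh.regMatrix_constantLTwo_form_le hΩ hC hK)
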